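/- For a finite Borel measure $\nu$ on $(0,1)$ let $\Lambda$ denote Lebesgue measure and let $$\mathcal E_\nu(f,g)=\int_{(0,1)}\nabla f\,\nabla g\,\mathrm d\Lambda$$ be the form whose domain consists of all $f\in H_0^1(0,1)$ (functions $f$ on $[0,1]$ with $f(0)=f(1)=0$ and $f(x)=\int_0^x\nabla f\,\mathrm d\Lambda$ for some $\nabla f\in L^2_\Lambda$) that are affine linear on every connected component of $[0,1]\setminus\operatorname{supp}\nu$. A function $f\neq0$ in the domain is an eigenfunction with eigenvalue $\lambda$ if $\mathcal E_\nu(f,g)=\lambda\int fg\,\mathrm d\nu$ for all $g$ in the domain. Let $N_\nu(x)$ be the number of eigenvalues (counted with multiplicity) not exceeding $x$, and, with the convention $\log 0=-\infty$, let $$\underline s_\nu=\liminf_{x\to\infty}\frac{\log N_\nu(x)}{\log x},\qquad \overline s_\nu=\limsup_{x\to\infty}\frac{\log N_\nu(x)}{\log x}$$ be the lower and upper spectral dimension of $\nu$; if they coincide, the common value is the spectral dimension of $\nu$. Let $\mathcal N^R_\nu(x)$ be the least cardinality of a finite partition of $(0,1]$ into intervals $(c_k,c_{k+1}]$, with no $c_k$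 an atom of $\nu$, such that $\nu(C)\Lambda(C)<1/x$ for every member $C$. For $m>1$ let $\mathcal N^L_{m,\nu}(x)$ be the largest cardinality of a finite disjoint collection of subintervals $C$ of $[0,1]$, with no atoms of $\nu$ at their endpoints, such that $\nu(\langle C\rangle_m)\Lambda(\langle C\rangle_m)\ge\frac{4}{x(m-1)}$ for each $C$, where $\langle C\rangle_m$ is the closed interval of length $\Lambda(C)/m$ centred in $C$. The measure $\nu$ is called regular if $$\sup_{m>1}\liminf_{x\to\infty}\frac{\log\mathcal N^L_{m,\nu}(x)}{\log x}=\limsup_{x\to\infty}\frac{\log\mathcal N^R_\nu(x)}{\log x}.$$ For $\alpha>0$ let $\mathcal N_{\alpha,\nu}(n)$ be the number of $0\le k<2^n$ with $\nu\big((k2^{-n},(k+1)2^{-n}]\big)\ge2^{-\alpha n}$. The measure $\nu$ is called MF-regular if $$\sup_{\alpha>0}\frac1{1+\alpha}\liminf_{n\to\infty}\frac{\log^+\mathcal N_{\alpha,\nu}(n)}{\log2^n}=\sup_{\alpha>0}\frac1{1+\alpha}\limsup_{n\to\infty}\frac{\log^+\mathcal N_{\alpha,\nu}(n)}{\log2^n}.$$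 **Corollary.** Let $\nu_1,\nu_2$ be finite Borel measures on $(0,1)$. Then $$\overline s_{\nu_1+\nu_2}=\max\{\overline s_{\nu_1},\overline s_{\nu_2}\}.$$ If additionally $\underline s_{\nu_1}=\overline s_{\nu_1}\ge\overline s_{\nu_2}$, then the spectral dimension of $\nu_1+\nu_2$ exists and equals $\overline s_{\nu_1}$. If $\underline s_{\nu_1}=\overline s_{\nu_1}\ge\overline s_{\nu_2}$ and $\nu_1$ is regular, then $\nu_1+\nu_2$ is regular; likewise, if $\underline s_{\nu_1}=\overline s_{\nu_1}\ge\overline s_{\nu_2}$ and $\nu_1$ is MF-regular, then $\nu_1+\nu_2$ is MF-regular. -/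

import Mathlib

open MeasureTheory Set Filter
open scoped ENNReal

namespace KreinFeller

noncomputable section

/-!
Functions on the ambient interval `[0, 1]` are represented by functions `ℝ → ℝ` which vanish
outside `[0, 1]`. A Borel measure on `(0, 1)` is a Borel measure on `ℝ` for which the complement of
`(0, 1)` is a null set.
-/

/-- `g` is a weak derivative of `f` on `[0, 1]`: `g ∈ L²([0, 1])` with respect to Lebesgue measure
and `f x = f 0 + ∫_{[0, x]} g` for all `x ∈ [0, 1]`. -/
def IsWeakDeriv (f g : ℝ → ℝ) : Prop :=
  MemLp g 2 (volume.restrict (Icc (0 : ℝ) 1)) ∧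
    ∀ x ∈ Icc (0 : ℝ) 1, f x = f 0 + ∫ t in Icc 0 x, g t

/-- The Sobolev space `H¹₀(0, 1)`: functions with a weak derivative in `L²` vanishing at `0` and
`1` (and, by the above convention, outside `[0, 1]`). -/
def MemH10 (f : ℝ → ℝ) : Prop :=
  (∃ g, IsWeakDeriv f g) ∧ f 0 = 0 ∧ f 1 = 0 ∧ ∀ x ∉ Icc (0 : ℝ) 1, f x = 0

open Classical in
/-- The weak derivative `∇f` (unique up to Lebesgue null sets), if there is one. -/
def weakDeriv (f : ℝ → ℝ) : ℝ → ℝ :=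
  if h : ∃ g, IsWeakDeriv f g then h.choose else 0

/-- The space `C_ν([0, 1])` of functions which are continuous on `[0, 1]` and affine linear on each
connected component of `[0, 1] \ supp ν`. -/
def MemCnu (ν : Measure ℝ) (f : ℝ → ℝ) : Prop :=
  ContinuousOn f (Icc 0 1) ∧
    ∀ y ∈ Icc (0 : ℝ) 1 \ ν.support, ∃ p q : ℝ,
      ∀ z ∈ connectedComponentIn (Icc (0 : ℝ) 1 \ ν.support) y, f z = p * z + q

/-- The Dirichlet domain `dom(𝓔_ν) = H¹₀(0, 1) ∩ C_ν([0, 1])`. -/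
def MemDom (ν : Measure ℝ) (f : ℝ → ℝ) : Prop :=
  MemH10 f ∧ MemCnu ν f

/-- The form `𝓔_ν(f, g) = ∫_{(0, 1)} ∇f ∇g` (with respect to Lebesgue measure). -/
def energy (f g : ℝ → ℝ) : ℝ :=
  ∫ t in Ioo (0 : ℝ) 1, weakDeriv f t * weakDeriv g t

/-- `f` is an eigenfunction of `𝓔_ν` with eigenvalue `l`. -/
def IsEigenfunction (ν : Measure ℝ) (l : ℝ) (f : ℝ → ℝ) : Prop :=
  MemDom ν f ∧ f ≠ 0 ∧ ∀ g, MemDom ν g → energy f g = l * ∫ x, f x * g x ∂ν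

/-- The eigenvalue counting function `N_ν(x)`: the number of eigenvalues of `𝓔_ν` not exceeding
`x`, counted with multiplicity, i.e. the number of linearly independent eigenfunctions with
eigenvalue at most `x`. -/
def eigenvalueCount (ν : Measure ℝ) (x : ℝ) : ℕ∞ :=
  Cardinal.toENat
    (Module.rank ℝ (Submodule.span ℝ {f : ℝ → ℝ | ∃ l ≤ x, IsEigenfunction ν l f}))

/-- `log N(x) / log x` as an extended real number, with `log 0 = -∞`. -/
def logRatio (N : ℝ → ℕ∞) (x : ℝ) : EReal :=
  ENNReal.log (N x : ℝ≥0∞) / ((Real.log x : ℝ) : EReal)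

/-- The lower spectral dimension of `ν`. -/
def lowerSpectralDim (ν : Measure ℝ) : EReal :=
  liminf (logRatio (eigenvalueCount ν)) atTop

/-- The upper spectral dimension of `ν`. -/
def upperSpectralDim (ν : Measure ℝ) : EReal :=
  limsup (logRatio (eigenvalueCount ν)) atTop

/-- The points `0 = c 0 < c 1 < ... < c n = 1`, none of which is an atom of `ν`, determine the
`ν`-partition of `[0, 1]` into the `n` intervals `(c k, c (k + 1)]`. -/
def IsNuPartition (ν : Measure ℝ) {n : ℕ} (c : Fin (n + 1) → ℝ) : Prop :=
  StrictMono c ∧ c 0 = 0 ∧ c (Fin.last n) = 1 ∧ ∀ k, ν {c k} = 0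

/-- The least cardinality of a `ν`-partition all of whose members `C` satisfy
`ν(C) Λ(C) < 1 / x`, where `Λ` is Lebesgue measure. -/
def partitionCount (ν : Measure ℝ) (x : ℝ) : ℕ∞ :=
  ⨅ (n : ℕ) (_ : ∃ c : Fin (n + 1) → ℝ, IsNuPartition ν c ∧
    ∀ k : Fin n, ν.real (Ioc (c k.castSucc) (c k.succ)) * (c k.succ - c k.castSucc) < 1 / x),
    (n : ℕ∞)

/-- The upper `ν`-partition entropy. -/
def upperEntropy (ν : Measure ℝ) : EReal :=
  limsup (logRatio (partitionCount ν)) atTop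

/-- The closed interval of length `(b - a) / m` with the same centre as the interval from `a` to
`b`. -/
def core (m a b : ℝ) : Set ℝ :=
  Icc ((a + b) / 2 - (b - a) / (2 * m)) ((a + b) / 2 + (b - a) / (2 * m))

/-- The largest cardinality of a finite disjoint collection of subintervals `C` of `[0, 1]` without
atoms of `ν` at their endpoints such that `ν(⟨C⟩) Λ(⟨C⟩) ≥ 4 / (x (m - 1))`, where `⟨C⟩` is the
interval of length `Λ(C) / m` centred in `C`. -/
def packingCount (ν : Measure ℝ) (m x : ℝ) : ℕ∞ :=
  ⨆ (n : ℕ) (_ : ∃ a b : Fin n → ℝ,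
    (∀ k, 0 ≤ a k ∧ a k < b k ∧ b k ≤ 1 ∧ ν {a k} = 0 ∧ ν {b k} = 0) ∧
    Pairwise (fun j k => Disjoint (Ioo (a j) (b j)) (Ioo (a k) (b k))) ∧
    ∀ k, 4 / (x * (m - 1)) ≤ ν.real (core m (a k) (b k)) * ((b k - a k) / m)),
    (n : ℕ∞)

/-- The lower `m`-reduced `ν`-partition entropy. -/
def lowerReducedEntropy (ν : Measure ℝ) (m : ℝ) : EReal :=
  liminf (logRatio (packingCount ν m)) atTop

/-- `ν` is regular: the supremum over `m > 1` of its lower `m`-reduced partition entropies equals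
its upper partition entropy. -/
def IsRegular (ν : Measure ℝ) : Prop :=
  (⨆ (m : ℝ) (_ : 1 < m), lowerReducedEntropy ν m) = upperEntropy ν

/-- The number of dyadic intervals `(k 2⁻ⁿ, (k + 1) 2⁻ⁿ]`, `0 ≤ k < 2ⁿ`, of `ν`-measure at least
`2^(-α n)`. -/
def dyadicCount (ν : Measure ℝ) (α : ℝ) (n : ℕ) : ℕ :=
  {k : ℕ | k < 2 ^ n ∧
    (2 : ℝ) ^ (-α * n) ≤ ν.real (Ioc ((k : ℝ) / 2 ^ n) (((k : ℝ) + 1) / 2 ^ n))}.ncard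

/-- `log⁺ (dyadicCount ν α n) / log 2ⁿ`. -/
def dyadicRatio (ν : Measure ℝ) (α : ℝ) (n : ℕ) : EReal :=
  ((Real.posLog (dyadicCount ν α n) / Real.log (2 ^ n) : ℝ) : EReal)

/-- The lower optimized coarse multifractal dimension. -/
def lowerMFDim (ν : Measure ℝ) : EReal :=
  ⨆ (α : ℝ) (_ : 0 < α), liminf (dyadicRatio ν α) atTop / ((1 + α : ℝ) : EReal)

/-- The upper optimized coarse multifractal dimension. -/
def upperMFDim (ν : Measure ℝ) : EReal :=
  ⨆ (α : ℝ) (_ : 0 < α), limsup (dyadicRatio ν α) atTop / ((1 + α : ℝ) : EReal)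

/-- `ν` is MF-regular: its lower and upper optimized coarse multifractal dimensions coincide. -/
def IsMFRegular (ν : Measure ℝ) : Prop :=
  lowerMFDim ν = upperMFDim ν

end

end KreinFeller

open scoped InnerProductSpace Topology

/-! Taking derivatives identifies `H¹₀(0,1)` isometrically with the mean-zero functions in
`L²([0,1])`, a space independent of `ν`. On it the form `∫ f g dν` is represented by `kernelOp ν`,
the `ν`-integral of the rank-one operators built from the Green's vectors `bridge x`: a compact,
positive operator, additive in `ν`. The range of this operator consists of derivatives of functions
in the Dirichlet domain of `ν`, so eigenvalues `λ` of the form are exactly the inverses of its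
positive eigenvalues (`isEigenfunction_primitive_iff`, `eigenvalueCount_eq_spectralCount`).

The min-max principle then makes `N_ν` monotone in `ν` and gives `N_{ν₁+ν₂}(x) ≤ N_{ν₁}(2x) +
N_{ν₂}(2x)`. Neither the factor 2 nor the sum of two terms affects the exponent, which settles the
statements about spectral dimensions.

For regularity, the point is the chain: upper spectral dimension ≤ upper partition entropy ≤ upper
multifractal dimension ≤ max(upper spectral dimension, 0). The links are a Poincaré inequality on
partition cells, a dyadic stopping-time partition, and trapezoidal test functions over heavy dyadic
intervals. Hence both upper quantities are controlled by the upper spectral dimension, which is the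
same for `ν₁` and `ν₁ + ν₂`. The lower quantities are monotone in `ν`, so equality of lower and
upper for `ν₁` squeezes those of the sum together. The maximum with 0 covers measures whose spectral
dimension is `-∞`. -/

namespace KreinFeller

/-! ### Min-max counting of eigenvalues of compact positive operators. -/

section SpectralCounting

variable {E : Type*} [NormedAddCommGroup E] [InnerProductSpace ℝ E]

/-- The sum of the eigenspaces of `T` to eigenvalues at least `s`. -/
noncomputable def upperEigenspace (T : E →L[ℝ] E) (s : ℝ) : Submodule ℝ E :=
  ⨆ μ : {μ : ℝ // s ≤ μ}, Module.End.eigenspace (T : E →ₗ[ℝ] E) μ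

/-- The number of eigenvalues of `T` that are at least `s`, counted with multiplicity. -/
noncomputable def spectralCount (T : E →L[ℝ] E) (s : ℝ) : ℕ∞ :=
  Cardinal.toENat (Module.rank ℝ (upperEigenspace T s))

/-- Distinct eigenspaces are orthogonal, so both quadratic forms are diagonal in the
eigencomponents, and each component carries a weight at least `s`. -/
theorem mul_norm_sq_le_inner_of_mem_upperEigenspace {T : E →L[ℝ] E} (hT : T.IsSymmetric) {s : ℝ}
    {g : E} (hg : g ∈ upperEigenspace T s) : s * ‖g‖ ^ 2 ≤ ⟪T g, g⟫_ℝ := by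
  classical
  rw [upperEigenspace, Submodule.mem_iSup_iff_exists_finsupp] at hg
  obtain ⟨f, hf, rfl⟩ := hg
  have orth : ∀ i j : {μ : ℝ // s ≤ μ}, i ≠ j → ⟪f i, f j⟫_ℝ = 0 := fun i j hij =>
    (hT.orthogonalFamily_eigenspaces.isOrtho (fun h => hij (Subtype.ext h))).inner_eq (hf i) (hf j)
  have hTf : ∀ i, T (f i) = (i : ℝ) • f i := fun i =>
    Module.End.mem_eigenspace_iff.1 (hf i)
  have h1 : ⟪T (f.sum fun _ x => x), f.sum fun _ x => x⟫_ℝ =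
      ∑ i ∈ f.support, (i : ℝ) * ‖f i‖ ^ 2 := by
    rw [Finsupp.sum, map_sum, sum_inner]
    refine Finset.sum_congr rfl fun i hi => ?_
    rw [inner_sum, Finset.sum_eq_single i, hTf, real_inner_smul_left, real_inner_self_eq_norm_sq]
    · intro j _ hj
      rw [hTf, real_inner_smul_left, orth i j hj.symm, mul_zero]
    · exact fun h => absurd hi h
  have h2 : ‖f.sum fun _ x => x‖ ^ 2 = ∑ i ∈ f.support, ‖f i‖ ^ 2 := by
    rw [← real_inner_self_eq_norm_sq, Finsupp.sum, sum_inner]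
    refine Finset.sum_congr rfl fun i hi => ?_
    rw [inner_sum, Finset.sum_eq_single i, real_inner_self_eq_norm_sq]
    · exact fun j _ hj => orth i j hj.symm
    · exact fun h => absurd hi h
  rw [h1, h2, Finset.mul_sum]
  exact Finset.sum_le_sum fun i _ => mul_le_mul_of_nonneg_right i.2 (sq_nonneg _)

/-- The complement of the upper eigenspace is invariant. If the restriction of `T` to it had norm at
least `s`, that norm would be an eigenvalue whose eigenvector also lies in the upper eigenspace. -/
theorem inner_lt_of_mem_orthogonal_upperEigenspace [CompleteSpace E] {T : E →L[ℝ] E}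
    (hc : IsCompactOperator T) (hT : T.IsSymmetric) (hpos : ∀ g, 0 ≤ ⟪T g, g⟫_ℝ)
    {s : ℝ} (hs : 0 < s) {g : E} (hg : g ∈ (upperEigenspace T s)ᗮ) (hg0 : g ≠ 0) :
    ⟪T g, g⟫_ℝ < s * ‖g‖ ^ 2 := by
  set W := upperEigenspace T s with hW
  have hinv : ∀ v ∈ Wᗮ, T v ∈ Wᗮ := by
    intro v hv
    rw [hW, upperEigenspace, ← Submodule.iInf_orthogonal, Submodule.mem_iInf] at hv ⊢
    intro μ w hw
    have h1 := hT w v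
    have h2 : T w = (μ : ℝ) • w := Module.End.mem_eigenspace_iff.1 hw
    have h3 : ⟪w, v⟫_ℝ = 0 := hv μ w hw
    rw [ContinuousLinearMap.coe_coe, h2, real_inner_smul_left, h3, mul_zero] at h1
    exact h1.symm
  let S : Wᗮ →L[ℝ] Wᗮ := T.restrict hinv
  have hSc : IsCompactOperator S := hc.restrict' hinv
  have hSs : S.IsSymmetric := hT.restrict_invariant hinv
  have hSapp : ∀ v : Wᗮ, ((S v : Wᗮ) : E) = T v := fun v => rfl
  have : Nontrivial Wᗮ := ⟨⟨⟨g, hg⟩, 0, fun h => hg0 (congrArg Subtype.val h)⟩⟩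
  have hnorm : ‖S‖ < s := by
    by_contra! hle
    -- Positivity selects `‖S‖` rather than `-‖S‖`: outside the spectrum, the Rayleigh quotients
    -- would stay below `‖S‖ - ε`, although the supremum of their absolute values is `‖S‖`.
    have hspec : algebraMap ℝ ℝ ‖S‖ ∈ spectrum ℝ S := by
      by_contra hres
      obtain ⟨ε, hε, h⟩ := S.rayleighQuotient_le_of_norm_mem_resolventSet (𝕜 := ℝ)
        (by simpa [spectrum] using hres)
      have h2 := S.norm_eq_iSup_rayleighQuotient hSs
      have h3 : ∀ v, |S.rayleighQuotient v| ≤ ‖S‖ - ε := by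
        intro v
        rw [abs_of_nonneg]
        · exact h v
        · refine div_nonneg ?_ (sq_nonneg _)
          exact hpos v
      have h4 := ciSup_le h3
      linarith
    have hne : algebraMap ℝ ℝ ‖S‖ ≠ 0 := by simpa using (hs.trans_le hle).ne'
    obtain ⟨v, hv, hv0⟩ := ((hSc.hasEigenvalue_iff_mem_spectrum hne).2 hspec).exists_hasEigenvector
    have hv1 : T (v : E) = ‖S‖ • (v : E) := by
      rw [← hSapp]
      simpa using congrArg Subtype.val (Module.End.mem_eigenspace_iff.1 hv)
    have hvW : (v : E) ∈ W :=
      Submodule.mem_iSup_of_mem (⟨‖S‖, hle⟩ : {μ : ℝ // s ≤ μ})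
        (Module.End.mem_eigenspace_iff.2 hv1)
    have h0 := v.2 v hvW
    exact hv0 (Subtype.ext (inner_self_eq_zero.1 h0))
  have hgn : 0 < ‖g‖ := norm_pos_iff.2 hg0
  calc ⟪T g, g⟫_ℝ = ⟪S ⟨g, hg⟩, (⟨g, hg⟩ : Wᗮ)⟫_ℝ := rfl
    _ ≤ ‖S ⟨g, hg⟩‖ * ‖(⟨g, hg⟩ : Wᗮ)‖ := real_inner_le_norm _ _
    _ ≤ ‖S‖ * ‖(⟨g, hg⟩ : Wᗮ)‖ * ‖(⟨g, hg⟩ : Wᗮ)‖ := by gcongr; exact S.le_opNorm _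
    _ = ‖S‖ * ‖g‖ ^ 2 := by rw [Submodule.coe_norm]; ring
    _ < s * ‖g‖ ^ 2 := by gcongr

/-- Orthogonal projection onto `B` is injective on `A`; when `B` has infinite dimension the bound is
`⊤`. -/
theorem toENat_rank_le_of_disjoint_orthogonal (A B : Submodule ℝ E)
    (h : ∀ a ∈ A, a ∈ Bᗮ → a = 0) :
    Cardinal.toENat (Module.rank ℝ A) ≤ Cardinal.toENat (Module.rank ℝ B) := by
  by_cases hB : Module.rank ℝ B < Cardinal.aleph0
  · have : FiniteDimensional ℝ B := Module.rank_lt_aleph0_iff.1 hB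
    refine Cardinal.toENat.monotone' ?_
    refine LinearMap.rank_le_of_injective
      ((B.orthogonalProjectionOnto : E →ₗ[ℝ] B).comp A.subtype) ?_
    rw [injective_iff_map_eq_zero]
    intro a ha
    exact Subtype.ext (h a a.2 (Submodule.orthogonalProjectionOnto_eq_zero_iff.1 ha))
  · rw [Cardinal.toENat_eq_top.2 (not_lt.1 hB)]
    exact le_top

theorem toENat_rank_sup_le (A B : Submodule ℝ E) :
    Cardinal.toENat (Module.rank ℝ (A ⊔ B : Submodule ℝ E)) ≤
      Cardinal.toENat (Module.rank ℝ A) + Cardinal.toENat (Module.rank ℝ B) := by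
  rw [← map_add]
  exact Cardinal.toENat.monotone' (Submodule.rank_add_le_rank_add_rank A B)

variable [CompleteSpace E]

/-- The variational half of min-max: a nonzero vector of `V` orthogonal to the upper eigenspace
would violate the strict upper bound valid there. -/
theorem toENat_rank_le_spectralCount {T : E →L[ℝ] E}
    (hc : IsCompactOperator T) (hT : T.IsSymmetric) (hpos : ∀ g, 0 ≤ ⟪T g, g⟫_ℝ)
    {s : ℝ} (hs : 0 < s) (V : Submodule ℝ E) (hV : ∀ g ∈ V, s * ‖g‖ ^ 2 ≤ ⟪T g, g⟫_ℝ) :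
    Cardinal.toENat (Module.rank ℝ V) ≤ spectralCount T s := by
  refine toENat_rank_le_of_disjoint_orthogonal V _ fun a ha hao => ?_
  by_contra h0
  exact (inner_lt_of_mem_orthogonal_upperEigenspace hc hT hpos hs hao h0).not_ge (hV a ha)

theorem spectralCount_mono {T₁ T₂ : E →L[ℝ] E} (hT₁ : T₁.IsSymmetric)
    (hc : IsCompactOperator T₂) (hT : T₂.IsSymmetric) (hpos : ∀ g, 0 ≤ ⟪T₂ g, g⟫_ℝ)
    (hle : ∀ g, ⟪T₁ g, g⟫_ℝ ≤ ⟪T₂ g, g⟫_ℝ) {s : ℝ} (hs : 0 < s) :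
    spectralCount T₁ s ≤ spectralCount T₂ s :=
  toENat_rank_le_spectralCount hc hT hpos hs _ fun g hg =>
    (mul_norm_sq_le_inner_of_mem_upperEigenspace hT₁ hg).trans (hle g)

/-- A Weyl inequality: on vectors orthogonal to both upper eigenspaces at level `s / 2`, each form
is below `s / 2`, so the sum is below `s`. -/
theorem spectralCount_add_le {T₁ T₂ : E →L[ℝ] E} (h₁ : T₁.IsSymmetric) (h₂ : T₂.IsSymmetric)
    (hc₁ : IsCompactOperator T₁) (hc₂ : IsCompactOperator T₂)
    (hpos₁ : ∀ g, 0 ≤ ⟪T₁ g, g⟫_ℝ) (hpos₂ : ∀ g, 0 ≤ ⟪T₂ g, g⟫_ℝ) {s : ℝ} (hs : 0 < s) :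
    spectralCount (T₁ + T₂) s ≤ spectralCount T₁ (s / 2) + spectralCount T₂ (s / 2) := by
  refine le_trans ?_ (toENat_rank_sup_le _ _)
  refine toENat_rank_le_of_disjoint_orthogonal _ _ fun g hg hgo => ?_
  by_contra h0
  rw [← Submodule.inf_orthogonal] at hgo
  have k₁ := inner_lt_of_mem_orthogonal_upperEigenspace hc₁ h₁ hpos₁ (half_pos hs) hgo.1 h0
  have k₂ := inner_lt_of_mem_orthogonal_upperEigenspace hc₂ h₂ hpos₂ (half_pos hs) hgo.2 h0
  have hsym : (T₁ + T₂).IsSymmetric := by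
    simpa using LinearMap.IsSymmetric.add h₁ h₂
  have k := mul_norm_sq_le_inner_of_mem_upperEigenspace hsym hg
  rw [_root_.add_apply, inner_add_left] at k
  linarith

end SpectralCounting

/-! ### The Hilbert space model: Green's vectors and primitives. -/

/-- Lebesgue measure on `[0, 1]`. -/
noncomputable abbrev unitVolume : Measure ℝ := volume.restrict (Icc (0 : ℝ) 1)

/-- The Hilbert space `L²([0, 1])`. -/
abbrev L2Unit : Type := Lp ℝ 2 unitVolume

/-- The indicator function of `(0, x]`. -/
noncomputable def stepFun (x : ℝ) : L2Unit :=
  indicatorConstLp 2 (measurableSet_Ioc : MeasurableSet (Ioc (0 : ℝ) x))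
    (measure_ne_top unitVolume _) (1 : ℝ)

theorem inner_stepFun {x : ℝ} (hx : x ∈ Icc (0 : ℝ) 1) (g : L2Unit) :
    ⟪stepFun x, g⟫_ℝ = ∫ t in Ioc 0 x, g t := by
  rw [stepFun, L2.inner_indicatorConstLp_one, Measure.restrict_restrict measurableSet_Ioc,
    inter_eq_left.2 (Ioc_subset_Icc_self.trans (Icc_subset_Icc le_rfl hx.2))]

theorem inner_stepFun_stepFun {x y : ℝ} (hx : x ∈ Icc (0 : ℝ) 1) (hy : y ∈ Icc (0 : ℝ) 1) :
    ⟪stepFun x, stepFun y⟫_ℝ = min x y := by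
  have h : Ioc 0 x ∩ Ioc 0 y ∩ Icc (0 : ℝ) 1 = Ioc 0 (min x y) := by
    ext t
    simp only [mem_inter_iff, mem_Ioc, mem_Icc, le_min_iff]
    constructor
    · rintro ⟨⟨⟨h1, h2⟩, h3, h4⟩, h5, h6⟩
      exact ⟨h1, h2, h4⟩
    · rintro ⟨h1, h2, h4⟩
      exact ⟨⟨⟨h1, h2⟩, h1, h4⟩, h1.le, h2.trans hx.2⟩
  rw [stepFun, stepFun, L2.inner_indicatorConstLp_one_indicatorConstLp_one measurableSet_Ioc
    measurableSet_Ioc, measureReal_def, Measure.restrict_apply (by measurability), h,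
    Real.volume_Ioc, sub_zero, ENNReal.toReal_ofReal (le_min hx.1 hy.1)]
  rfl

/-- The nearest point projection onto `[0, 1]`. -/
noncomputable def clip (x : ℝ) : ℝ := max 0 (min x 1)

theorem clip_mem (x : ℝ) : clip x ∈ Icc (0 : ℝ) 1 :=
  ⟨le_max_left _ _, max_le zero_le_one (min_le_right _ _)⟩

theorem clip_of_mem {x : ℝ} (hx : x ∈ Icc (0 : ℝ) 1) : clip x = x := by
  rw [clip, min_eq_left hx.2, max_eq_right hx.1]

theorem continuous_clip : Continuous clip := by unfold clip; fun_prop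

/-- An increment has squared norm `|x - y|`, so the path is Hölder continuous of order 1/2. Clipping
extends it to all of `ℝ`, ready for integration against `ν`. -/
theorem continuous_stepFun_clip : Continuous fun x => stepFun (clip x) := by
  have key : ∀ x y, ‖stepFun (clip x) - stepFun (clip y)‖ = √|clip x - clip y| := by
    intro x y
    rw [eq_comm, Real.sqrt_eq_iff_mul_self_eq (abs_nonneg _) (norm_nonneg _), ← sq,
      ← real_inner_self_eq_norm_sq, inner_sub_left, inner_sub_right, inner_sub_right]
    have hx := clip_mem x
    have hy := clip_mem y
    rw [inner_stepFun_stepFun hx hx, inner_stepFun_stepFun hx hy, inner_stepFun_stepFun hy hx,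
      inner_stepFun_stepFun hy hy, min_self, min_self]
    rcases le_total (clip x) (clip y) with h | h
    · rw [min_eq_left h, min_eq_right h, abs_of_nonpos (by linarith)]; ring
    · rw [min_eq_right h, min_eq_left h, abs_of_nonneg (by linarith)]; ring
  rw [continuous_iff_continuousAt]
  intro x
  rw [ContinuousAt, tendsto_iff_norm_sub_tendsto_zero]
  simp_rw [key]
  have : Continuous fun y => √|clip y - clip x| := by
    have := continuous_clip
    fun_prop
  simpa using this.tendsto x

/-- The projection of `stepFun x` onto the functions with mean zero. -/
noncomputable def bridge (x : ℝ) : L2Unit := stepFun (clip x) - clip x • stepFun 1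

theorem continuous_bridge : Continuous bridge :=
  continuous_stepFun_clip.sub (continuous_clip.smul continuous_const)

theorem inner_stepFun_one_bridge (x : ℝ) : ⟪stepFun 1, bridge x⟫_ℝ = 0 := by
  have h1 : (1 : ℝ) ∈ Icc (0 : ℝ) 1 := by simp
  rw [bridge, inner_sub_right, real_inner_smul_right, inner_stepFun_stepFun h1 (clip_mem x),
    inner_stepFun_stepFun h1 h1, min_eq_right (clip_mem x).2]
  simp

/-- The Green's function of the second derivative with Dirichlet boundary conditions. -/
theorem inner_bridge_bridge {x y : ℝ} (hx : x ∈ Icc (0 : ℝ) 1) (hy : y ∈ Icc (0 : ℝ) 1) :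
    ⟪bridge x, bridge y⟫_ℝ = min x y - x * y := by
  rw [bridge, inner_sub_left, real_inner_smul_left, inner_stepFun_one_bridge, mul_zero, sub_zero,
    bridge, clip_of_mem hx, clip_of_mem hy, inner_sub_right, real_inner_smul_right,
    inner_stepFun_stepFun hx hy, inner_stepFun_stepFun hx (by simp), min_eq_left hx.2]
  ring

theorem bridge_eq_zero {x : ℝ} (hx : x ∉ Ioo (0 : ℝ) 1) : bridge x = 0 := by
  rcases le_or_gt x 0 with h | h
  · have : clip x = 0 := max_eq_left ((min_le_left _ _).trans h)
    rw [bridge, this, zero_smul, sub_zero, stepFun, ← norm_eq_zero, norm_indicatorConstLp] <;> simp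
  · have h1 : 1 ≤ x := by
      by_contra! h1
      exact hx ⟨h, h1⟩
    have : clip x = 1 := by simp [clip, min_eq_right h1]
    rw [bridge, this, one_smul, sub_self]

theorem norm_bridge_le (x : ℝ) : ‖bridge x‖ ≤ 1 := by
  by_cases hx : x ∈ Ioo (0 : ℝ) 1
  · have h := inner_bridge_bridge (Ioo_subset_Icc_self hx) (Ioo_subset_Icc_self hx)
    rw [real_inner_self_eq_norm_sq, min_self] at h
    nlinarith [hx.1, hx.2, norm_nonneg (bridge x)]
  · rw [bridge_eq_zero hx, norm_zero]; exact zero_le_one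

/-- The primitive of `g - ∫ g`, extended by `0` outside `[0, 1]`. -/
noncomputable def primitive : L2Unit →ₗ[ℝ] ℝ → ℝ where
  toFun g x := ⟪bridge x, g⟫_ℝ
  map_add' g h := by ext x; simp [inner_add_right]
  map_smul' c g := by ext x; simp [real_inner_smul_right]

theorem primitive_apply (g : L2Unit) (x : ℝ) : primitive g x = ⟪bridge x, g⟫_ℝ := rfl

theorem continuous_primitive (g : L2Unit) : Continuous (primitive g) :=
  continuous_bridge.inner continuous_const

theorem abs_primitive_le (g : L2Unit) (x : ℝ) : |primitive g x| ≤ ‖g‖ :=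
  (abs_real_inner_le_norm _ _).trans
    (mul_le_of_le_one_left (norm_nonneg _) (norm_bridge_le x))

theorem primitive_eq_zero (g : L2Unit) {x : ℝ} (hx : x ∉ Ioo (0 : ℝ) 1) : primitive g x = 0 := by
  rw [primitive_apply, bridge_eq_zero hx, inner_zero_left]

theorem primitive_of_mem {g : L2Unit} (hg : ⟪stepFun 1, g⟫_ℝ = 0) {x : ℝ}
    (hx : x ∈ Icc (0 : ℝ) 1) : primitive g x = ∫ t in Ioc 0 x, g t := by
  rw [primitive_apply, bridge, inner_sub_left, real_inner_smul_left, hg, clip_of_mem hx,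
    inner_stepFun hx]
  ring

theorem integrable_primitive_mul (ν : Measure ℝ) [IsFiniteMeasure ν] (g h : L2Unit) :
    Integrable (fun x => primitive g x * primitive h x) ν := by
  refine Integrable.of_bound
    ((continuous_primitive g).mul (continuous_primitive h)).aestronglyMeasurable (‖g‖ * ‖h‖)
    (ae_of_all _ fun x => ?_)
  rw [Real.norm_eq_abs, abs_mul]
  exact mul_le_mul (abs_primitive_le g x) (abs_primitive_le h x) (abs_nonneg _) (norm_nonneg _)

/-! ### The solution operator. -/

/-- The Krein–Feller solution operator, `⟪T g, h⟫ = ∫ Jg Jh dν` with `J` the primitive. -/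
noncomputable def kernelOp (ν : Measure ℝ) : L2Unit →L[ℝ] L2Unit :=
  ∫ x, InnerProductSpace.rankOne ℝ (bridge x) (bridge x) ∂ν

theorem continuous_rankOne_bridge :
    Continuous fun x => InnerProductSpace.rankOne ℝ (bridge x) (bridge x) := by
  have h := (InnerProductSpace.rankOne ℝ (E := L2Unit) (F := L2Unit)).continuous.comp
    continuous_bridge
  exact h.clm_apply continuous_bridge

theorem integrable_rankOne_bridge (ν : Measure ℝ) [IsFiniteMeasure ν] :
    Integrable (fun x => InnerProductSpace.rankOne ℝ (bridge x) (bridge x)) ν := by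
  refine Integrable.of_bound continuous_rankOne_bridge.aestronglyMeasurable 1
    (ae_of_all _ fun x => ?_)
  rw [InnerProductSpace.norm_rankOne]
  exact mul_le_one₀ (norm_bridge_le x) (norm_nonneg _) (norm_bridge_le x)

theorem kernelOp_apply (ν : Measure ℝ) [IsFiniteMeasure ν] (g : L2Unit) :
    kernelOp ν g = ∫ x, primitive g x • bridge x ∂ν := by
  rw [kernelOp, ContinuousLinearMap.integral_apply (integrable_rankOne_bridge ν)]
  rfl

theorem integrable_primitive_smul_bridge (ν : Measure ℝ) [IsFiniteMeasure ν] (g : L2Unit) :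
    Integrable (fun x => primitive g x • bridge x) ν := by
  refine Integrable.of_bound
    ((continuous_primitive g).smul continuous_bridge).aestronglyMeasurable ‖g‖
    (ae_of_all _ fun x => ?_)
  rw [norm_smul, Real.norm_eq_abs]
  exact (mul_le_of_le_one_right (abs_nonneg _) (norm_bridge_le x)).trans (abs_primitive_le g x)

theorem inner_kernelOp (ν : Measure ℝ) [IsFiniteMeasure ν] (g h : L2Unit) :
    ⟪kernelOp ν g, h⟫_ℝ = ∫ x, primitive g x * primitive h x ∂ν := by
  rw [kernelOp_apply, real_inner_comm, ← integral_inner (integrable_primitive_smul_bridge ν g)]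
  congr 1
  ext x
  rw [real_inner_smul_right, primitive_apply h, real_inner_comm]

theorem inner_kernelOp_self_nonneg (ν : Measure ℝ) [IsFiniteMeasure ν] (g : L2Unit) :
    0 ≤ ⟪kernelOp ν g, g⟫_ℝ := by
  rw [inner_kernelOp]
  exact integral_nonneg fun x => mul_self_nonneg _

theorem kernelOp_isSymmetric (ν : Measure ℝ) [IsFiniteMeasure ν] : (kernelOp ν).IsSymmetric := by
  intro g h
  simp only [ContinuousLinearMap.coe_coe]
  rw [real_inner_comm (kernelOp ν h) g, inner_kernelOp, inner_kernelOp]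
  simp_rw [mul_comm]

/-- Compact operators form a closed subspace containing every rank-one operator, and the integral is
the total mass times an average of such operators. -/
theorem isCompactOperator_kernelOp (ν : Measure ℝ) [IsFiniteMeasure ν] :
    IsCompactOperator (kernelOp ν) := by
  let K := compactOperator (RingHom.id ℝ) L2Unit L2Unit
  have hK : IsClosed (K : Set (L2Unit →L[ℝ] L2Unit)) := isClosed_setOfPred_isCompactOperator
  have hmem : ∀ x, InnerProductSpace.rankOne ℝ (bridge x) (bridge x) ∈ K := by
    intro x
    have h : IsCompactOperator (ContinuousLinearMap.toSpanSingleton ℝ (bridge x)) :=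
      isCompactOperator_of_locallyCompactSpace_rng _
    rw [InnerProductSpace.rankOne_def']
    exact h.comp_clm _
  change kernelOp ν ∈ K
  rcases eq_or_ne ν 0 with rfl | hν
  · rw [kernelOp, integral_zero_measure]
    exact K.zero_mem
  · have : NeZero ν := ⟨hν⟩
    rw [kernelOp, ← measure_smul_average]
    exact K.smul_mem _ (Convex.average_mem K.convex hK (ae_of_all _ hmem)
      (integrable_rankOne_bridge ν))

theorem kernelOp_add (ν₁ ν₂ : Measure ℝ) [IsFiniteMeasure ν₁] [IsFiniteMeasure ν₂] :
    kernelOp (ν₁ + ν₂) = kernelOp ν₁ + kernelOp ν₂ :=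
  integral_add_measure (integrable_rankOne_bridge ν₁) (integrable_rankOne_bridge ν₂)

theorem inner_stepFun_one_kernelOp (ν : Measure ℝ) [IsFiniteMeasure ν] (g : L2Unit) :
    ⟪stepFun 1, kernelOp ν g⟫_ℝ = 0 := by
  rw [kernelOp_apply, ← integral_inner (integrable_primitive_smul_bridge ν g)]
  simp [real_inner_smul_right, inner_stepFun_one_bridge]

/-! ### Eigenfunctions of the form versus eigenvectors of the solution operator. -/

section Correspondence

theorem L2Unit.integrableOn (g : L2Unit) : IntegrableOn g (Icc 0 1) :=
  (Lp.memLp g).integrable one_le_two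

/-- By Lebesgue differentiation, `h` is almost everywhere the derivative of its primitive. This
gives uniqueness of weak derivatives and injectivity of `primitive` on mean-zero functions. -/
theorem ae_eq_zero_of_setIntegral_Icc_eq_zero {h : ℝ → ℝ} (hi : IntegrableOn h (Icc 0 1))
    (h0 : ∀ x ∈ Icc (0 : ℝ) 1, ∫ t in Icc 0 x, h t = 0) : h =ᵐ[unitVolume] 0 := by
  have hii : IntervalIntegrable h volume 0 1 :=
    (intervalIntegrable_iff_integrableOn_Icc_of_le zero_le_one).2 hi
  have n0 : ∀ᵐ x : ℝ, x ≠ 0 := by simp [ae_iff, measure_singleton]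
  have n1 : ∀ᵐ x : ℝ, x ≠ 1 := by simp [ae_iff, measure_singleton]
  rw [EventuallyEq, ae_restrict_iff' measurableSet_Icc]
  filter_upwards [hii.ae_hasDerivAt_integral, n0, n1] with x hx hx0 hx1 hmem
  rw [uIcc_of_le zero_le_one] at hx
  have hd := hx hmem 0 (by simp)
  have hev : (fun y => ∫ t in (0 : ℝ)..y, h t) =ᶠ[𝓝 x] fun _ => 0 := by
    filter_upwards [Ioo_mem_nhds (lt_of_le_of_ne hmem.1 hx0.symm) (lt_of_le_of_ne hmem.2 hx1)]
      with y hy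
    rw [intervalIntegral.integral_of_le hy.1.le, ← integral_Icc_eq_integral_Ioc]
    exact h0 y (Ioo_subset_Icc_self hy)
  exact hd.unique ((hasDerivAt_const x (0 : ℝ)).congr_of_eventuallyEq hev)

theorem IsWeakDeriv.ae_eq {f g₁ g₂ : ℝ → ℝ} (h₁ : IsWeakDeriv f g₁) (h₂ : IsWeakDeriv f g₂) :
    g₁ =ᵐ[unitVolume] g₂ := by
  have i₁ : IntegrableOn g₁ (Icc 0 1) := h₁.1.integrable one_le_two
  have i₂ : IntegrableOn g₂ (Icc 0 1) := h₂.1.integrable one_le_two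
  have h := ae_eq_zero_of_setIntegral_Icc_eq_zero (i₁.sub i₂) fun x hx => by
    have hs : Icc 0 x ⊆ Icc (0 : ℝ) 1 := Icc_subset_Icc le_rfl hx.2
    simp only [Pi.sub_apply]
    rw [integral_sub (i₁.mono_set hs) (i₂.mono_set hs)]
    linarith [h₁.2 x hx, h₂.2 x hx]
  filter_upwards [h] with x hx
  exact sub_eq_zero.1 hx

theorem isWeakDeriv_primitive {g : L2Unit} (hg : ⟪stepFun 1, g⟫_ℝ = 0) :
    IsWeakDeriv (primitive g) g := by
  refine ⟨Lp.memLp g, fun x hx => ?_⟩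
  rw [primitive_of_mem hg hx, primitive_eq_zero g (x := 0) (by simp),
    integral_Icc_eq_integral_Ioc, zero_add]

theorem memH10_primitive {g : L2Unit} (hg : ⟪stepFun 1, g⟫_ℝ = 0) : MemH10 (primitive g) :=
  ⟨⟨g, isWeakDeriv_primitive hg⟩, primitive_eq_zero g (by simp), primitive_eq_zero g (by simp),
    fun _ hx => primitive_eq_zero g fun h => hx (Ioo_subset_Icc_self h)⟩

theorem MemH10.exists_primitive_eq {f : ℝ → ℝ} (hf : MemH10 f) :
    ∃ g : L2Unit, ⟪stepFun 1, g⟫_ℝ = 0 ∧ primitive g = f := by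
  obtain ⟨⟨g, hg, hint⟩, h0, h1, hout⟩ := hf
  have key : ∀ x ∈ Icc (0 : ℝ) 1, ∫ t in Ioc 0 x, hg.toLp g t = f x := by
    intro x hx
    rw [hint x hx, h0, zero_add, integral_Icc_eq_integral_Ioc]
    refine integral_congr_ae ?_
    exact ae_restrict_of_ae_restrict_of_subset
      (Ioc_subset_Icc_self.trans (Icc_subset_Icc le_rfl hx.2)) hg.coeFn_toLp
  have hmean : ⟪stepFun 1, hg.toLp g⟫_ℝ = 0 := by
    rw [inner_stepFun (by simp), key 1 (by simp), h1]
  refine ⟨hg.toLp g, hmean, ?_⟩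
  ext x
  by_cases hx : x ∈ Icc (0 : ℝ) 1
  · rw [primitive_of_mem hmean hx, key x hx]
  · rw [primitive_eq_zero _ fun h => hx (Ioo_subset_Icc_self h), hout x hx]

theorem eq_zero_of_primitive_eq_zero {g : L2Unit} (hg : ⟪stepFun 1, g⟫_ℝ = 0)
    (h : primitive g = 0) : g = 0 := by
  refine (Lp.eq_zero_iff_ae_eq_zero).2 ?_
  refine ae_eq_zero_of_setIntegral_Icc_eq_zero g.integrableOn fun x hx => ?_
  rw [integral_Icc_eq_integral_Ioc, ← primitive_of_mem hg hx, h, Pi.zero_apply]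

theorem weakDeriv_primitive {g : L2Unit} (hg : ⟪stepFun 1, g⟫_ℝ = 0) :
    weakDeriv (primitive g) =ᵐ[unitVolume] g := by
  have h : ∃ d, IsWeakDeriv (primitive g) d := ⟨g, isWeakDeriv_primitive hg⟩
  rw [weakDeriv, dif_pos h]
  exact h.choose_spec.ae_eq (isWeakDeriv_primitive hg)

theorem energy_primitive {g h : L2Unit} (hg : ⟪stepFun 1, g⟫_ℝ = 0) (hh : ⟪stepFun 1, h⟫_ℝ = 0) :
    energy (primitive g) (primitive h) = ⟪g, h⟫_ℝ := by
  rw [energy, ← integral_Icc_eq_integral_Ioo, L2.inner_def]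
  refine integral_congr_ae ?_
  filter_upwards [weakDeriv_primitive hg, weakDeriv_primitive hh] with x hx hx'
  rw [hx, hx', real_inner_comm]
  rfl

theorem MemCnu.sub {ν : Measure ℝ} {f g : ℝ → ℝ} (hf : MemCnu ν f) (hg : MemCnu ν g) : MemCnu ν (f - g) := by
  refine ⟨hf.1.sub hg.1, fun y hy => ?_⟩
  obtain ⟨p, q, h⟩ := hf.2 y hy
  obtain ⟨p', q', h'⟩ := hg.2 y hy
  refine ⟨p - p', q - q', fun z hz => ?_⟩
  rw [Pi.sub_apply, h z hz, h' z hz]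
  ring

theorem MemCnu.smul {ν : Measure ℝ} {f : ℝ → ℝ} (hf : MemCnu ν f) (c : ℝ) : MemCnu ν (c • f) := by
  refine ⟨hf.1.const_smul c, fun y hy => ?_⟩
  obtain ⟨p, q, h⟩ := hf.2 y hy
  refine ⟨c * p, c * q, fun z hz => ?_⟩
  rw [Pi.smul_apply, h z hz, smul_eq_mul]
  ring

variable {ν : Measure ℝ} [IsFiniteMeasure ν]

/-- Off the support of `ν`, the range of the solution operator consists of affine functions. -/
theorem memCnu_primitive_kernelOp (hν : ν (Ioo 0 1)ᶜ = 0) (g : L2Unit) :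
    MemCnu ν (primitive (kernelOp ν g)) := by
  refine ⟨(continuous_primitive _).continuousOn, fun y hy => ?_⟩
  set C := connectedComponentIn (Icc (0 : ℝ) 1 \ ν.support) y with hC
  have hyC : y ∈ C := mem_connectedComponentIn hy
  have hCsub : C ⊆ Icc (0 : ℝ) 1 \ ν.support := connectedComponentIn_subset _ _
  have hCord : C.OrdConnected := isPreconnected_connectedComponentIn.ordConnected
  have hae : ∀ᵐ x ∂ν, x ∈ Ioo (0 : ℝ) 1 ∧ x ∉ C := by
    have h1 : ∀ᵐ x ∂ν, x ∈ Ioo (0 : ℝ) 1 := hν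
    filter_upwards [h1, (Measure.support_mem_ae : ν.support ∈ ae ν)] with x hx hx'
    exact ⟨hx, fun h => (hCsub h).2 hx'⟩
  -- `a` and `b` integrate to slope and intercept. The Green's function `min x z - x z` is affine in
  -- `z` on either side of `x`; since `ν`-almost no `x` lies in the component, whether `x < z` is
  -- already decided by the base point `y`.
  let a : ℝ → ℝ := fun x => primitive g x * (if x < y then 0 else 1) - primitive g x * x
  let b : ℝ → ℝ := fun x => primitive g x * (if x < y then x else 0)
  refine ⟨∫ x, a x ∂ν, ∫ x, b x ∂ν, fun z hz => ?_⟩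
  have hbd : ∀ᵐ x ∂ν, ‖x‖ ≤ 1 := by
    filter_upwards [hae] with x hx
    rw [Real.norm_eq_abs, abs_of_pos hx.1.1]
    exact hx.1.2.le
  have hJ : Integrable (primitive g) ν := Integrable.of_bound
    (continuous_primitive g).aestronglyMeasurable ‖g‖ (ae_of_all _ (abs_primitive_le g))
  have hmeas : MeasurableSet {x : ℝ | x < y} := measurableSet_Iio
  have ha : Integrable a ν := by
    refine Integrable.sub (hJ.mul_bdd (c := 1) ?_ ?_) (hJ.mul_bdd (c := 1) ?_ hbd)
    · exact (Measurable.ite hmeas measurable_const measurable_const).aestronglyMeasurable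
    · exact ae_of_all _ fun x => by split_ifs <;> simp
    · exact measurable_id.aestronglyMeasurable
  have hb : Integrable b ν := by
    refine hJ.mul_bdd (c := 1) ?_ ?_
    · exact (Measurable.ite hmeas measurable_id measurable_const).aestronglyMeasurable
    · filter_upwards [hbd] with x hx
      split_ifs
      · exact hx
      · simp
  rw [primitive_apply, kernelOp_apply, ← integral_inner (integrable_primitive_smul_bridge ν g),
    ← integral_mul_const, ← integral_add (ha.mul_const z) hb]
  refine integral_congr_ae ?_
  filter_upwards [hae] with x hx
  rw [real_inner_smul_right, inner_bridge_bridge (hCsub hz).1 (Ioo_subset_Icc_self hx.1)]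
  simp only [a, b]
  by_cases hxy : x < y
  · have hxz : x < z := by
      by_contra! h
      exact hx.2 (hCord.out hz hyC ⟨h, hxy.le⟩)
    rw [if_pos hxy, if_pos hxy, min_eq_right hxz.le]
    ring
  · have hxz : z < x := by
      by_contra! h
      exact hx.2 (hCord.out hyC hz ⟨not_lt.1 hxy, h⟩)
    rw [if_neg hxy, if_neg hxy, min_eq_left hxz.le]
    ring

/-- The weak equation may only be tested within the domain of `ν`. This suffices because the
residual `g - l • kernelOp ν g` itself yields an admissible test function, and testing with it shows
that it vanishes. Conversely, `g = l • kernelOp ν g` forces membership in the domain. -/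
theorem isEigenfunction_primitive_iff (hν : ν (Ioo 0 1)ᶜ = 0) {g : L2Unit}
    (hg : ⟪stepFun 1, g⟫_ℝ = 0) {l : ℝ} :
    IsEigenfunction ν l (primitive g) ↔ g ≠ 0 ∧ 0 < l ∧ kernelOp ν g = l⁻¹ • g := by
  constructor
  · rintro ⟨hdom, hne, heig⟩
    have hg0 : g ≠ 0 := by
      rintro rfl
      exact hne (map_zero _)
    have hgn : 0 < ⟪g, g⟫_ℝ := real_inner_self_pos.2 hg0
    have heig' : ∀ h : L2Unit, ⟪stepFun 1, h⟫_ℝ = 0 → MemCnu ν (primitive h) →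
        ⟪g, h⟫_ℝ = l * ⟪kernelOp ν g, h⟫_ℝ := by
      intro h hh hC
      rw [← energy_primitive hg hh, inner_kernelOp]
      exact heig _ ⟨memH10_primitive hh, hC⟩
    -- Testing with `g` itself gives `‖g‖² = l ⟪T g, g⟫`, where the last factor is nonnegative.
    have hl : 0 < l := by
      have h1 := heig' g hg hdom.2
      have h2 := inner_kernelOp_self_nonneg ν g
      by_contra! h
      nlinarith
    refine ⟨hg0, hl, ?_⟩
    have hu1 : ⟪stepFun 1, g - l • kernelOp ν g⟫_ℝ = 0 := by
      rw [inner_sub_right, real_inner_smul_right, hg, inner_stepFun_one_kernelOp]; ring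
    have hu2 : MemCnu ν (primitive (g - l • kernelOp ν g)) := by
      rw [map_sub, map_smul]
      exact hdom.2.sub ((memCnu_primitive_kernelOp hν g).smul l)
    have hu3 := heig' _ hu1 hu2
    have hu4 : ⟪g - l • kernelOp ν g, g - l • kernelOp ν g⟫_ℝ = 0 := by
      rw [inner_sub_left, hu3, real_inner_smul_left, sub_self]
    have hu5 := sub_eq_zero.1 (inner_self_eq_zero.1 hu4)
    rw [eq_comm, inv_smul_eq_iff₀ hl.ne']
    exact hu5
  · rintro ⟨hg0, hl, hT⟩
    have hg' : g = l • kernelOp ν g := by rw [hT, smul_inv_smul₀ hl.ne']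
    refine ⟨⟨memH10_primitive hg, ?_⟩, fun h => hg0 (eq_zero_of_primitive_eq_zero hg h), ?_⟩
    · rw [hg', map_smul]
      exact (memCnu_primitive_kernelOp hν g).smul l
    · intro f hf
      obtain ⟨h, hh, rfl⟩ := hf.1.exists_primitive_eq
      rw [energy_primitive hg hh, ← inner_kernelOp, hT, real_inner_smul_left,
        mul_inv_cancel_left₀ hl.ne']

theorem inner_stepFun_one_of_mem_upperEigenspace {s : ℝ} (hs : 0 < s) {g : L2Unit}
    (hg : g ∈ upperEigenspace (kernelOp ν) s) : ⟪stepFun 1, g⟫_ℝ = 0 := by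
  have hle : upperEigenspace (kernelOp ν) s ≤ (ℝ ∙ stepFun 1)ᗮ := by
    refine iSup_le fun μ h hh => ?_
    have hμ : (0 : ℝ) < μ := hs.trans_le μ.2
    have hT : kernelOp ν h = (μ : ℝ) • h := Module.End.mem_eigenspace_iff.1 hh
    rw [Submodule.mem_orthogonal_singleton_iff_inner_right]
    have h0 := inner_stepFun_one_kernelOp ν h
    rw [hT, real_inner_smul_right] at h0
    exact (mul_eq_zero.1 h0).resolve_left hμ.ne'
  exact Submodule.mem_orthogonal_singleton_iff_inner_right.1 (hle hg)

theorem eigenvalueCount_eq_spectralCount (hν : ν (Ioo 0 1)ᶜ = 0) {x : ℝ} (hx : 0 < x) :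
    eigenvalueCount ν x = spectralCount (kernelOp ν) (1 / x) := by
  have hx' : 0 < 1 / x := one_div_pos.2 hx
  have hspan : Submodule.span ℝ {f : ℝ → ℝ | ∃ l ≤ x, IsEigenfunction ν l f} =
      (upperEigenspace (kernelOp ν) (1 / x)).map primitive := by
    apply le_antisymm
    · refine Submodule.span_le.2 ?_
      rintro f ⟨l, hl, hf⟩
      obtain ⟨g, hg, rfl⟩ := hf.1.1.exists_primitive_eq
      obtain ⟨-, hl0, hT⟩ := (isEigenfunction_primitive_iff hν hg).1 hf
      refine ⟨g, ?_, rfl⟩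
      have hle : 1 / x ≤ l⁻¹ := by
        rw [one_div]
        exact inv_anti₀ hl0 hl
      exact Submodule.mem_iSup_of_mem (⟨l⁻¹, hle⟩ : {μ : ℝ // 1 / x ≤ μ})
        (Module.End.mem_eigenspace_iff.2 hT)
    · rw [upperEigenspace, Submodule.map_iSup]
      refine iSup_le fun μ => ?_
      rintro f ⟨g, hgμ, rfl⟩
      rcases eq_or_ne g 0 with rfl | hg0
      · rw [map_zero]; exact Submodule.zero_mem _
      have hμ : (0 : ℝ) < μ := hx'.trans_le μ.2
      have hg : ⟪stepFun 1, g⟫_ℝ = 0 :=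
        inner_stepFun_one_of_mem_upperEigenspace hx' (Submodule.mem_iSup_of_mem μ hgμ)
      refine Submodule.subset_span ⟨(μ : ℝ)⁻¹, ?_, ?_⟩
      · rw [inv_le_comm₀ hμ hx, ← one_div]
        exact μ.2
      · refine (isEigenfunction_primitive_iff hν hg).2 ⟨hg0, inv_pos.2 hμ, ?_⟩
        rw [inv_inv]
        exact Module.End.mem_eigenspace_iff.1 hgμ
  have hinj : Function.Injective
      (primitive.domRestrict (upperEigenspace (kernelOp ν) (1 / x))) := by
    rw [injective_iff_map_eq_zero]
    intro g hg
    exact Subtype.ext (eq_zero_of_primitive_eq_zero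
      (inner_stepFun_one_of_mem_upperEigenspace hx' g.2) hg)
  rw [eigenvalueCount, spectralCount, hspan, ← LinearMap.range_domRestrict,
    (LinearEquiv.ofInjective _ hinj).rank_eq]

theorem eigenvalueCount_mono {ν₁ ν₂ : Measure ℝ} [IsFiniteMeasure ν₁] [IsFiniteMeasure ν₂]
    (h₁ : ν₁ (Ioo 0 1)ᶜ = 0) (h₂ : ν₂ (Ioo 0 1)ᶜ = 0) (hle : ν₁ ≤ ν₂) {x : ℝ} (hx : 0 < x) :
    eigenvalueCount ν₁ x ≤ eigenvalueCount ν₂ x := by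
  rw [eigenvalueCount_eq_spectralCount h₁ hx, eigenvalueCount_eq_spectralCount h₂ hx]
  refine spectralCount_mono (kernelOp_isSymmetric ν₁) (isCompactOperator_kernelOp ν₂)
    (kernelOp_isSymmetric ν₂) (inner_kernelOp_self_nonneg ν₂) (fun g => ?_) (one_div_pos.2 hx)
  rw [inner_kernelOp, inner_kernelOp]
  exact integral_mono_measure hle (ae_of_all _ fun x => mul_self_nonneg _)
    (integrable_primitive_mul ν₂ g g)

theorem add_compl_Ioo_eq_zero {ν₁ ν₂ : Measure ℝ} (h₁ : ν₁ (Ioo 0 1)ᶜ = 0)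
    (h₂ : ν₂ (Ioo 0 1)ᶜ = 0) : (ν₁ + ν₂) (Ioo 0 1)ᶜ = 0 := by
  rw [Measure.add_apply, h₁, h₂, add_zero]

theorem eigenvalueCount_add_le {ν₁ ν₂ : Measure ℝ} [IsFiniteMeasure ν₁] [IsFiniteMeasure ν₂]
    (h₁ : ν₁ (Ioo 0 1)ᶜ = 0) (h₂ : ν₂ (Ioo 0 1)ᶜ = 0) {x : ℝ} (hx : 0 < x) :
    eigenvalueCount (ν₁ + ν₂) x ≤ eigenvalueCount ν₁ (2 * x) + eigenvalueCount ν₂ (2 * x) := by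
  rw [eigenvalueCount_eq_spectralCount h₁ (by positivity),
    eigenvalueCount_eq_spectralCount h₂ (by positivity),
    eigenvalueCount_eq_spectralCount (add_compl_Ioo_eq_zero h₁ h₂) hx, kernelOp_add,
    show 1 / (2 * x) = 1 / x / 2 by field_simp]
  exact spectralCount_add_le (kernelOp_isSymmetric ν₁) (kernelOp_isSymmetric ν₂)
    (isCompactOperator_kernelOp ν₁) (isCompactOperator_kernelOp ν₂)
    (inner_kernelOp_self_nonneg ν₁) (inner_kernelOp_self_nonneg ν₂) (one_div_pos.2 hx)

end Correspondence

/-! ### Trapezoidal test functions. -/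

/-- Orthogonality for both forms lets the Rayleigh bound pass from the individual vectors to their
span, which has dimension `n`. -/
theorem card_le_spectralCount {E : Type*} [NormedAddCommGroup E] [InnerProductSpace ℝ E]
    [CompleteSpace E] {T : E →L[ℝ] E} (hc : IsCompactOperator T) (hT : T.IsSymmetric)
    (hpos : ∀ g, 0 ≤ ⟪T g, g⟫_ℝ) {s : ℝ} (hs : 0 < s) {n : ℕ} (v : Fin n → E)
    (hv : ∀ k, v k ≠ 0) (orth : Pairwise fun j k => ⟪v j, v k⟫_ℝ = 0)
    (orthT : Pairwise fun j k => ⟪T (v j), v k⟫_ℝ = 0)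
    (hle : ∀ k, s * ‖v k‖ ^ 2 ≤ ⟪T (v k), v k⟫_ℝ) : (n : ℕ∞) ≤ spectralCount T s := by
  have hli : LinearIndependent ℝ v := linearIndependent_of_ne_zero_of_inner_eq_zero hv orth
  have hrank : Cardinal.toENat (Module.rank ℝ (Submodule.span ℝ (range v))) = n := by
    have : FiniteDimensional ℝ (Submodule.span ℝ (range v)) :=
      FiniteDimensional.span_of_finite ℝ (finite_range v)
    rw [← Module.finrank_eq_rank, finrank_span_eq_card hli, Fintype.card_fin, Cardinal.toENat_nat]
  rw [← hrank]
  refine toENat_rank_le_spectralCount hc hT hpos hs _ fun g hg => ?_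
  obtain ⟨c, rfl⟩ := (Submodule.mem_span_range_iff_exists_fun ℝ).1 hg
  have h1 : ‖∑ k, c k • v k‖ ^ 2 = ∑ k, c k ^ 2 * ‖v k‖ ^ 2 := by
    rw [← real_inner_self_eq_norm_sq, sum_inner]
    refine Finset.sum_congr rfl fun i _ => ?_
    rw [inner_sum, Finset.sum_eq_single i]
    · rw [real_inner_smul_left, real_inner_smul_right, real_inner_self_eq_norm_sq]; ring
    · intro j _ hj
      rw [real_inner_smul_left, real_inner_smul_right, orth hj.symm, mul_zero, mul_zero]
    · simp
  have h2 : ⟪T (∑ k, c k • v k), ∑ k, c k • v k⟫_ℝ = ∑ k, c k ^ 2 * ⟪T (v k), v k⟫_ℝ := by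
    rw [map_sum, sum_inner]
    refine Finset.sum_congr rfl fun i _ => ?_
    rw [inner_sum, Finset.sum_eq_single i]
    · rw [map_smul, real_inner_smul_left, real_inner_smul_right]; ring
    · intro j _ hj
      rw [map_smul, real_inner_smul_left, real_inner_smul_right, orthT hj.symm, mul_zero, mul_zero]
    · simp
  rw [h1, h2, Finset.mul_sum]
  refine Finset.sum_le_sum fun k _ => ?_
  nlinarith [mul_le_mul_of_nonneg_left (hle k) (sq_nonneg (c k))]

/-- The derivative of the trapezoidal function on `[a, b]` with slopes of width `w`. -/
noncomputable def trapezoidDeriv (a b w : ℝ) : L2Unit :=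
  stepFun (a + w) - stepFun a - (stepFun b - stepFun (b - w))

section Trapezoid

variable {a b w : ℝ}

theorem inner_stepFun_trapezoidDeriv (ha : 0 ≤ a) (hb : b ≤ 1) (hw : 0 < w) (hab : a + w ≤ b - w)
    {x : ℝ} (hx : x ∈ Icc (0 : ℝ) 1) :
    ⟪stepFun x, trapezoidDeriv a b w⟫_ℝ =
      min x (a + w) - min x a - (min x b - min x (b - w)) := by
  rw [trapezoidDeriv, inner_sub_right, inner_sub_right, inner_sub_right,
    inner_stepFun_stepFun hx, inner_stepFun_stepFun hx, inner_stepFun_stepFun hx,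
    inner_stepFun_stepFun hx] <;> constructor <;> linarith

theorem inner_stepFun_one_trapezoidDeriv (ha : 0 ≤ a) (hb : b ≤ 1) (hw : 0 < w)
    (hab : a + w ≤ b - w) : ⟪stepFun 1, trapezoidDeriv a b w⟫_ℝ = 0 := by
  rw [inner_stepFun_trapezoidDeriv ha hb hw hab (by simp), min_eq_right, min_eq_right,
    min_eq_right hb, min_eq_right] <;> linarith

theorem primitive_trapezoidDeriv (ha : 0 ≤ a) (hb : b ≤ 1) (hw : 0 < w) (hab : a + w ≤ b - w)
    {x : ℝ} (hx : x ∈ Icc (0 : ℝ) 1) :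
    primitive (trapezoidDeriv a b w) x =
      min x (a + w) - min x a - (min x b - min x (b - w)) := by
  rw [primitive_apply, bridge, inner_sub_left, real_inner_smul_left,
    inner_stepFun_one_trapezoidDeriv ha hb hw hab, clip_of_mem hx,
    inner_stepFun_trapezoidDeriv ha hb hw hab hx]
  ring

theorem primitive_trapezoidDeriv_of_mem (ha : 0 ≤ a) (hb : b ≤ 1) (hw : 0 < w)
    (hab : a + w ≤ b - w) {x : ℝ} (hx : x ∈ Icc (a + w) (b - w)) :
    primitive (trapezoidDeriv a b w) x = w := by
  have := hx.1
  have := hx.2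
  rw [primitive_trapezoidDeriv ha hb hw hab (by constructor <;> linarith), min_eq_right,
    min_eq_right, min_eq_left, min_eq_left] <;> linarith

theorem inner_stepFun_trapezoidDeriv_of_notMem (ha : 0 ≤ a) (hb : b ≤ 1) (hw : 0 < w)
    (hab : a + w ≤ b - w) {x : ℝ} (hx : x ∈ Icc (0 : ℝ) 1) (hx' : x ≤ a ∨ b ≤ x) :
    ⟪stepFun x, trapezoidDeriv a b w⟫_ℝ = 0 := by
  rw [inner_stepFun_trapezoidDeriv ha hb hw hab hx]
  rcases hx' with h | h
  · rw [min_eq_left, min_eq_left, min_eq_left, min_eq_left] <;> linarith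
  · rw [min_eq_right, min_eq_right, min_eq_right, min_eq_right] <;> linarith

theorem primitive_trapezoidDeriv_of_notMem (ha : 0 ≤ a) (hb : b ≤ 1) (hw : 0 < w)
    (hab : a + w ≤ b - w) {x : ℝ} (hx' : x ≤ a ∨ b ≤ x) :
    primitive (trapezoidDeriv a b w) x = 0 := by
  by_cases hx : x ∈ Ioo (0 : ℝ) 1
  · have hx := Ioo_subset_Icc_self hx
    rw [primitive_trapezoidDeriv ha hb hw hab hx, ← inner_stepFun_trapezoidDeriv ha hb hw hab hx,
      inner_stepFun_trapezoidDeriv_of_notMem ha hb hw hab hx hx']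
  · exact primitive_eq_zero _ hx

theorem norm_trapezoidDeriv_sq (ha : 0 ≤ a) (hb : b ≤ 1) (hw : 0 < w) (hab : a + w ≤ b - w) :
    ‖trapezoidDeriv a b w‖ ^ 2 = 2 * w := by
  rw [← real_inner_self_eq_norm_sq]
  nth_rw 1 [trapezoidDeriv]
  rw [inner_sub_left, inner_sub_left, inner_sub_left,
    inner_stepFun_trapezoidDeriv ha hb hw hab (x := a + w) (by constructor <;> linarith),
    inner_stepFun_trapezoidDeriv ha hb hw hab (x := b - w) (by constructor <;> linarith),
    inner_stepFun_trapezoidDeriv_of_notMem ha hb hw hab (x := a) (by constructor <;> linarith)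
      (Or.inl le_rfl),
    inner_stepFun_trapezoidDeriv_of_notMem ha hb hw hab (x := b) (by constructor <;> linarith)
      (Or.inr le_rfl),
    min_self, min_self, min_eq_right (by linarith : a ≤ a + w), min_eq_left hab,
    min_eq_left (by linarith : a + w ≤ b), min_eq_right hab,
    min_eq_right (by linarith : a ≤ b - w), min_eq_left (by linarith : b - w ≤ b)]
  ring

theorem inner_trapezoidDeriv_of_disjoint {a' b' w' : ℝ} (ha : 0 ≤ a) (hb : b ≤ 1) (hw : 0 < w)
    (hab : a + w ≤ b - w) (ha' : 0 ≤ a') (hb' : b' ≤ 1) (hw' : 0 < w') (hab' : a' + w' ≤ b' - w')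
    (h : b' ≤ a ∨ b ≤ a') : ⟪trapezoidDeriv a' b' w', trapezoidDeriv a b w⟫_ℝ = 0 := by
  have key : ∀ x ∈ Icc a' b', ⟪stepFun x, trapezoidDeriv a b w⟫_ℝ = 0 := fun x hx =>
    inner_stepFun_trapezoidDeriv_of_notMem ha hb hw hab ⟨ha'.trans hx.1, hx.2.trans hb'⟩
      (h.imp hx.2.trans fun h => h.trans hx.1)
  nth_rw 1 [trapezoidDeriv]
  rw [inner_sub_left, inner_sub_left, inner_sub_left, key, key, key, key]
  · ring
  all_goals constructor <;> linarith

end Trapezoid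

/-! ### Bounding the eigenvalue count by packings and partitions. -/

section Bounds

variable {ν : Measure ℝ} [IsFiniteMeasure ν]

/-- Over each interval take the trapezoid of height `w` on the core. Its energy is `2w` and its
`ν`-mass is at least `w² ν(core)`. Their ratio `w ν(core) / 2 = (m - 1)/4 · ν(core) · (b - a)/m` is
at least `1 / x` exactly under the packing threshold. -/
theorem card_le_eigenvalueCount (hν : ν (Ioo 0 1)ᶜ = 0) {m x : ℝ} (hm : 1 < m) (hx : 0 < x)
    {n : ℕ} (a b : Fin n → ℝ) (hab : ∀ k, 0 ≤ a k ∧ a k < b k ∧ b k ≤ 1)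
    (hdisj : Pairwise fun j k => Disjoint (Ioo (a j) (b j)) (Ioo (a k) (b k)))
    (hle : ∀ k, 4 / (x * (m - 1)) ≤ ν.real (core m (a k) (b k)) * ((b k - a k) / m)) :
    (n : ℕ∞) ≤ eigenvalueCount ν x := by
  have hm0 : 0 < m := by linarith
  have hm1 : 0 < m - 1 := by linarith
  -- Chosen so that the plateau `[a + w, b - w]` is the core.
  let w : Fin n → ℝ := fun k => (b k - a k) * (m - 1) / (2 * m)
  have hw : ∀ k, 0 < w k := fun k => by
    have := sub_pos.2 (hab k).2.1
    positivity
  have hwl : ∀ k, a k + w k = (a k + b k) / 2 - (b k - a k) / (2 * m) := fun k => by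
    simp only [w]; field_simp; ring
  have hwr : ∀ k, b k - w k = (a k + b k) / 2 + (b k - a k) / (2 * m) := fun k => by
    simp only [w]; field_simp; ring
  have hwab : ∀ k, a k + w k ≤ b k - w k := fun k => by
    have : 0 < (b k - a k) / (2 * m) := div_pos (sub_pos.2 (hab k).2.1) (by positivity)
    rw [hwl, hwr]; linarith
  have hcore : ∀ k, core m (a k) (b k) = Icc (a k + w k) (b k - w k) := fun k => by
    rw [hwl, hwr, core]
  have hsep : ∀ j k, j ≠ k → b j ≤ a k ∨ b k ≤ a j := by
    intro j k hjk
    have h := hdisj hjk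
    simp only [Ioo_disjoint_Ioo, min_le_iff, le_max_iff] at h
    have hj := (hab j).2.1
    have hk := (hab k).2.1
    rcases h with (h | h) | (h | h)
    · exact absurd h hj.not_ge
    · exact Or.inr h
    · exact Or.inl h
    · exact absurd h hk.not_ge
  rw [eigenvalueCount_eq_spectralCount hν hx]
  refine card_le_spectralCount (isCompactOperator_kernelOp ν) (kernelOp_isSymmetric ν)
    (inner_kernelOp_self_nonneg ν) (one_div_pos.2 hx)
    (fun k => trapezoidDeriv (a k) (b k) (w k)) (fun k h0 => ?_) (fun j k hjk => ?_)
    (fun j k hjk => ?_) fun k => ?_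
  · have h := norm_trapezoidDeriv_sq (hab k).1 (hab k).2.2 (hw k) (hwab k)
    rw [h0, norm_zero] at h
    linarith [hw k]
  · exact inner_trapezoidDeriv_of_disjoint (hab k).1 (hab k).2.2 (hw k) (hwab k)
      (hab j).1 (hab j).2.2 (hw j) (hwab j) (hsep j k hjk)
  · simp only [inner_kernelOp]
    refine integral_eq_zero_of_ae (ae_of_all _ fun x => ?_)
    simp only [Pi.zero_apply, mul_eq_zero]
    by_cases hxj : x ≤ a j ∨ b j ≤ x
    · exact Or.inl (primitive_trapezoidDeriv_of_notMem (hab j).1 (hab j).2.2 (hw j) (hwab j) hxj)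
    · right
      push Not at hxj
      refine primitive_trapezoidDeriv_of_notMem (hab k).1 (hab k).2.2 (hw k) (hwab k) ?_
      rcases hsep j k hjk with h | h
      · left; linarith
      · right; linarith
  · rw [norm_trapezoidDeriv_sq (hab k).1 (hab k).2.2 (hw k) (hwab k), inner_kernelOp]
    have h1 : w k ^ 2 * ν.real (core m (a k) (b k)) ≤
        ∫ y, primitive (trapezoidDeriv (a k) (b k) (w k)) y *
          primitive (trapezoidDeriv (a k) (b k) (w k)) y ∂ν := by
      have hmeas : MeasurableSet (core m (a k) (b k)) := measurableSet_Icc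
      have h2 : ∫ _ in core m (a k) (b k), w k ^ 2 ∂ν = w k ^ 2 * ν.real (core m (a k) (b k)) := by
        rw [setIntegral_const, smul_eq_mul, mul_comm]
      rw [← h2, ← integral_indicator hmeas]
      refine integral_mono ((integrable_const _).indicator hmeas)
        (integrable_primitive_mul ν _ _) fun y => ?_
      by_cases hy : y ∈ core m (a k) (b k)
      · rw [indicator_of_mem hy]
        rw [hcore] at hy
        dsimp only
        rw [primitive_trapezoidDeriv_of_mem (hab k).1 (hab k).2.2 (hw k) (hwab k) hy, sq]
      · rw [indicator_of_notMem hy]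
        exact mul_self_nonneg _
    refine le_trans ?_ h1
    have h3 := mul_le_mul_of_nonneg_left (hle k)
      (by have := hw k; positivity : 0 ≤ w k * (m - 1) / 2)
    calc 1 / x * (2 * w k) = w k * (m - 1) / 2 * (4 / (x * (m - 1))) := by field_simp; ring
      _ ≤ _ := h3
      _ = _ := by simp only [w]; field_simp

theorem packingCount_le_eigenvalueCount (hν : ν (Ioo 0 1)ᶜ = 0) {m x : ℝ} (hm : 1 < m)
    (hx : 0 < x) : packingCount ν m x ≤ eigenvalueCount ν x := by
  refine iSup₂_le fun n => ?_
  rintro ⟨a, b, hab, hdisj, hle⟩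
  exact card_le_eigenvalueCount hν hm hx a b
    (fun k => ⟨(hab k).1, (hab k).2.1, (hab k).2.2.1⟩) hdisj hle

theorem setIntegral_Ioc_eq_sum_fin {μ : Measure ℝ} {f : ℝ → ℝ} {n : ℕ} {c : Fin (n + 1) → ℝ}
    (hc : Monotone c) (hf : IntegrableOn f (Ioc (c 0) (c (Fin.last n))) μ) :
    ∫ x in Ioc (c 0) (c (Fin.last n)), f x ∂μ =
      ∑ k : Fin n, ∫ x in Ioc (c k.castSucc) (c k.succ), f x ∂μ := by
  induction n with
  | zero => simp
  | succ n ih =>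
    have h1 : c 0 ≤ c (Fin.last n).castSucc := hc (Fin.zero_le _)
    have h2 : c (Fin.last n).castSucc ≤ c (Fin.last (n + 1)) := hc (Fin.le_last _)
    rw [← Ioc_union_Ioc_eq_Ioc h1 h2] at hf ⊢
    rw [setIntegral_union (Ioc_disjoint_Ioc_of_le le_rfl) measurableSet_Ioc
      hf.left_of_union hf.right_of_union, Fin.sum_univ_castSucc]
    congr 1
    exact ih (c := c ∘ Fin.castSucc) (hc.comp Fin.strictMono_castSucc.monotone) hf.left_of_union

/-- Cauchy–Schwarz against the constant 1, read off from `∫ (g - r)² ≥ 0` at the mean value `r = I /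
V`. -/
theorem sq_setIntegral_le {A : Set ℝ} {g : ℝ → ℝ} (hA : volume A ≠ ∞)
    (hg : IntegrableOn g A) (hg2 : IntegrableOn (fun t => g t ^ 2) A) :
    (∫ t in A, g t) ^ 2 ≤ volume.real A * ∫ t in A, g t ^ 2 := by
  set I := ∫ t in A, g t
  set V := volume.real A with hV
  set Q := ∫ t in A, g t ^ 2
  have key : ∀ r : ℝ, 0 ≤ Q - 2 * r * I + r ^ 2 * V := by
    intro r
    have hconst : IntegrableOn (fun _ : ℝ => r ^ 2) A := integrableOn_const hA
    have h0 : 0 ≤ ∫ t in A, (g t - r) ^ 2 := integral_nonneg fun t => sq_nonneg _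
    have h1 : ∫ t in A, (g t - r) ^ 2 = Q - 2 * r * I + r ^ 2 * V := by
      have : (fun t => (g t - r) ^ 2) = fun t => g t ^ 2 - 2 * r * g t + r ^ 2 := by
        ext t; ring
      have hsub : IntegrableOn (fun t => g t ^ 2 - 2 * r * g t) A := hg2.sub (hg.const_mul _)
      rw [this, integral_add hsub hconst,
        integral_sub hg2 (hg.const_mul _), integral_const_mul, setIntegral_const, smul_eq_mul,
        mul_comm (r ^ 2)]
    rwa [h1] at h0
  have hV0 : 0 ≤ V := measureReal_nonneg
  rcases hV0.eq_or_lt with h | h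
  · have hA0 : volume A = 0 := (measureReal_eq_zero_iff hA).1 (hV ▸ h.symm)
    have : I = 0 := setIntegral_measure_zero _ hA0
    rw [this, ← h]; simp
  · have h1 := key (I / V)
    have h2 : Q - 2 * (I / V) * I + (I / V) ^ 2 * V = Q - I ^ 2 / V := by field_simp; ring
    rw [h2, sub_nonneg, div_le_iff₀ h] at h1
    linarith

theorem L2Unit.integrableOn_sq (g : L2Unit) : IntegrableOn (fun t => g t ^ 2) (Icc 0 1) :=
  (Lp.memLp g).integrable_sq

theorem L2Unit.norm_sq_eq (g : L2Unit) : ‖g‖ ^ 2 = ∫ t in Ioc 0 1, g t ^ 2 := by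
  rw [← real_inner_self_eq_norm_sq, L2.inner_def, ← integral_Icc_eq_integral_Ioc]
  refine integral_congr_ae (ae_of_all _ fun t => ?_)
  simp

/-- A Poincaré inequality on one cell: vanishing at the left endpoint makes the primitive at `z`
equal to `∫ g` over `(u, z]`, and Cauchy–Schwarz bounds it uniformly. -/
theorem setIntegral_primitive_sq_le {g : L2Unit} (hg : ⟪stepFun 1, g⟫_ℝ = 0) {u v : ℝ}
    (hu : 0 ≤ u) (huv : u ≤ v) (hv : v ≤ 1) (h0 : primitive g u = 0) :
    ∫ z in Ioc u v, primitive g z * primitive g z ∂ν ≤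
      ν.real (Ioc u v) * (v - u) * ∫ t in Ioc u v, g t ^ 2 := by
  have hsub : Ioc u v ⊆ Icc 0 1 := fun t ht => ⟨hu.trans ht.1.le, ht.2.trans hv⟩
  have hpt : ∀ z ∈ Ioc u v,
      primitive g z * primitive g z ≤ (v - u) * ∫ t in Ioc u v, g t ^ 2 := by
    intro z hz
    have hz1 : primitive g z = ∫ t in Ioc u z, g t := by
      have h1 := primitive_of_mem hg (x := u) ⟨hu, huv.trans hv⟩
      rw [h0] at h1
      rw [primitive_of_mem hg (hsub hz), ← Ioc_union_Ioc_eq_Ioc hu hz.1.le,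
        setIntegral_union (Ioc_disjoint_Ioc_of_le le_rfl) measurableSet_Ioc, ← h1, zero_add]
      · exact g.integrableOn.mono_set fun t ht => ⟨ht.1.le, ht.2.trans (huv.trans hv)⟩
      · exact g.integrableOn.mono_set ((Ioc_subset_Ioc_right hz.2).trans hsub)
    have hsub' : Ioc u z ⊆ Ioc u v := Ioc_subset_Ioc_right hz.2
    have h2 := sq_setIntegral_le (A := Ioc u z) (g := g) (by simp)
      (g.integrableOn.mono_set (hsub'.trans hsub)) (g.integrableOn_sq.mono_set (hsub'.trans hsub))
    rw [← sq, hz1]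
    refine h2.trans ?_
    rw [Real.volume_real_Ioc_of_le hz.1.le]
    refine mul_le_mul (by linarith [hz.2]) ?_ (integral_nonneg fun t => sq_nonneg _)
      (by linarith)
    exact setIntegral_mono_set (g.integrableOn_sq.mono_set hsub)
      (ae_of_all _ fun t => sq_nonneg _) (ae_of_all _ hsub')
  calc ∫ z in Ioc u v, primitive g z * primitive g z ∂ν
      ≤ ∫ _ in Ioc u v, ((v - u) * ∫ t in Ioc u v, g t ^ 2) ∂ν :=
        setIntegral_mono_on (integrable_primitive_mul ν g g).integrableOn
          (integrable_const _).integrableOn measurableSet_Ioc hpt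
    _ = _ := by rw [setIntegral_const, smul_eq_mul]; ring

/-- Evaluation at the `n` left endpoints is injective on the upper eigenspace: a nonzero element
vanishing at all of them would, by the Poincaré inequality on every cell, have Rayleigh quotient
below `1 / x`. -/
theorem eigenvalueCount_le_card (hν : ν (Ioo 0 1)ᶜ = 0) {x : ℝ} (hx : 0 < x) {n : ℕ}
    {c : Fin (n + 1) → ℝ} (hc : StrictMono c) (hc0 : c 0 = 0) (hc1 : c (Fin.last n) = 1)
    (hle : ∀ k : Fin n,
      ν.real (Ioc (c k.castSucc) (c k.succ)) * (c k.succ - c k.castSucc) < 1 / x) :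
    eigenvalueCount ν x ≤ n := by
  have hx' := one_div_pos.2 hx
  rw [eigenvalueCount_eq_spectralCount hν hx, spectralCount]
  set W := upperEigenspace (kernelOp ν) (1 / x)
  let ev : W →ₗ[ℝ] (Fin n → ℝ) :=
    LinearMap.pi fun k => (LinearMap.proj (c k.castSucc) ∘ₗ primitive) ∘ₗ W.subtype
  have hinj : Function.Injective ev := by
    rw [injective_iff_map_eq_zero]
    rintro ⟨g, hgW⟩ hev
    have hg := inner_stepFun_one_of_mem_upperEigenspace hx' hgW
    have hzero : ∀ k : Fin n, primitive g (c k.castSucc) = 0 := fun k => congrFun hev k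
    by_contra hne
    have hg0 : g ≠ 0 := fun h => hne (Subtype.ext h)
    have h1 := mul_norm_sq_le_inner_of_mem_upperEigenspace (kernelOp_isSymmetric ν) hgW
    have hr0 : ∀ i, 0 ≤ c i := fun i => hc0 ▸ hc.monotone (Fin.zero_le i)
    have hr1 : ∀ i, c i ≤ 1 := fun i => hc1 ▸ hc.monotone (Fin.le_last i)
    have h2 : ⟪kernelOp ν g, g⟫_ℝ =
        ∑ k : Fin n, ∫ z in Ioc (c k.castSucc) (c k.succ), primitive g z * primitive g z ∂ν := by
      rw [← setIntegral_Ioc_eq_sum_fin hc.monotone (integrable_primitive_mul ν g g).integrableOn,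
        inner_kernelOp, hc0, hc1, setIntegral_eq_integral_of_forall_compl_eq_zero]
      intro z hz
      rw [primitive_eq_zero g fun h => hz (Ioo_subset_Ioc_self h), mul_zero]
    have h3 : ‖g‖ ^ 2 = ∑ k : Fin n, ∫ t in Ioc (c k.castSucc) (c k.succ), g t ^ 2 := by
      rw [← setIntegral_Ioc_eq_sum_fin (c := c) hc.monotone, L2Unit.norm_sq_eq, hc0, hc1]
      rw [hc0, hc1]
      exact g.integrableOn_sq.mono_set Ioc_subset_Icc_self
    have hnn : ∀ k : Fin n, 0 ≤ ∫ t in Ioc (c k.castSucc) (c k.succ), g t ^ 2 := fun k =>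
      integral_nonneg fun t => sq_nonneg _
    have hpos : 0 < ‖g‖ ^ 2 := by
      have := norm_pos_iff.2 hg0
      positivity
    -- Some cell carries energy; the strict smallness of the cells is effective there and makes the
    -- summed inequality strict.
    obtain ⟨i, -, hi⟩ : ∃ i ∈ Finset.univ,
        (0 : ℝ) < ∫ t in Ioc (c (Fin.castSucc i)) (c (Fin.succ i)), g t ^ 2 := by
      by_contra! h
      rw [h3] at hpos
      exact hpos.not_ge (Finset.sum_nonpos h)
    have h4 : ⟪kernelOp ν g, g⟫_ℝ < 1 / x * ‖g‖ ^ 2 := by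
      rw [h2, h3, Finset.mul_sum]
      have hb : ∀ k : Fin n, _ := fun k => setIntegral_primitive_sq_le (ν := ν) hg
        (hr0 k.castSucc) (hc k.castSucc_lt_succ).le (hr1 k.succ) (hzero k)
      refine Finset.sum_lt_sum (fun k _ => (hb k).trans ?_) ⟨i, Finset.mem_univ _, ?_⟩
      · exact mul_le_mul_of_nonneg_right (hle k).le (hnn k)
      · exact (hb i).trans_lt (mul_lt_mul_of_pos_right (hle i) hi)
    exact h4.not_ge h1
  have := LinearMap.rank_le_of_injective ev hinj
  rw [rank_fin_fun] at this
  simpa using Cardinal.toENat.monotone' this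

theorem eigenvalueCount_le_partitionCount (hν : ν (Ioo 0 1)ᶜ = 0) {x : ℝ} (hx : 0 < x) :
    eigenvalueCount ν x ≤ partitionCount ν x := by
  refine le_iInf₂ fun n => ?_
  rintro ⟨c, ⟨hc, hc0, hc1, -⟩, hle⟩
  exact eigenvalueCount_le_card hν hx hc hc0 hc1 hle

end Bounds

/-! ### Growth exponents of counting functions. -/

section Growth

variable {N : ℝ → ℕ∞} {r : ℝ}

theorem logRatio_le_iff {x : ℝ} (hx : 1 < x) :
    logRatio N x ≤ r ↔ (N x : ℝ≥0∞) ≤ ENNReal.ofReal (x ^ r) := by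
  have hl := Real.log_pos hx
  have hx0 : 0 < x := by linarith
  rw [logRatio, EReal.div_le_iff_le_mul (by exact_mod_cast hl) (EReal.coe_ne_top _),
    ← ENNReal.log_le_log_iff, ENNReal.log_ofReal_of_pos (Real.rpow_pos_of_pos hx0 r),
    Real.log_rpow hx0, mul_comm r, EReal.coe_mul]

theorem le_logRatio_iff {x : ℝ} (hx : 1 < x) :
    r ≤ logRatio N x ↔ ENNReal.ofReal (x ^ r) ≤ (N x : ℝ≥0∞) := by
  have hl := Real.log_pos hx
  have hx0 : 0 < x := by linarith
  rw [logRatio, EReal.le_div_iff_mul_le (by exact_mod_cast hl) (EReal.coe_ne_top _),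
    ← ENNReal.log_le_log_iff, ENNReal.log_ofReal_of_pos (Real.rpow_pos_of_pos hx0 r),
    Real.log_rpow hx0, EReal.coe_mul]

theorem eventually_le_rpow_of_limsup_lt (h : limsup (logRatio N) atTop < r) :
    ∀ᶠ x in atTop, (N x : ℝ≥0∞) ≤ ENNReal.ofReal (x ^ r) := by
  filter_upwards [eventually_lt_of_limsup_lt h, eventually_gt_atTop 1] with x hx h1
  exact (logRatio_le_iff h1).1 hx.le

theorem eventually_rpow_le_of_lt_liminf (h : r < liminf (logRatio N) atTop) :
    ∀ᶠ x in atTop, ENNReal.ofReal (x ^ r) ≤ (N x : ℝ≥0∞) := by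
  filter_upwards [eventually_lt_of_lt_liminf h, eventually_gt_atTop 1] with x hx h1
  exact (le_logRatio_iff h1).1 hx.le

theorem eventually_const_mul_rpow_le (C : ℝ) {r r' : ℝ} (h : r < r') :
    ∀ᶠ x : ℝ in atTop, C * x ^ r ≤ x ^ r' := by
  filter_upwards [(tendsto_rpow_atTop (sub_pos.2 h)).eventually_ge_atTop C,
    eventually_gt_atTop 0] with x hx h0
  calc C * x ^ r ≤ x ^ (r' - r) * x ^ r :=
        mul_le_mul_of_nonneg_right hx (Real.rpow_nonneg h0.le r)
    _ = x ^ r' := by rw [← Real.rpow_add h0]; ring_nf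

/-- The constant `C` is absorbed by any exponent larger than `r`. -/
theorem limsup_logRatio_le (C : ℝ)
    (h : ∀ᶠ x in atTop, (N x : ℝ≥0∞) ≤ ENNReal.ofReal (C * x ^ r)) :
    limsup (logRatio N) atTop ≤ r := by
  refine EReal.le_of_forall_lt_iff_le.1 fun r' hr' => ?_
  have hr : r < r' := by exact_mod_cast hr'
  refine limsup_le_of_le (by isBoundedDefault) ?_
  filter_upwards [h, eventually_const_mul_rpow_le C hr, eventually_gt_atTop 1] with x h1 h2 h3
  exact (logRatio_le_iff h3).2 (h1.trans (ENNReal.ofReal_le_ofReal h2))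

theorem le_liminf_logRatio {C : ℝ} (hC : 0 < C)
    (h : ∀ᶠ x in atTop, ENNReal.ofReal (C * x ^ r) ≤ (N x : ℝ≥0∞)) :
    r ≤ liminf (logRatio N) atTop := by
  refine EReal.ge_of_forall_gt_iff_ge.1 fun r' hr' => ?_
  have hr : r' < r := by exact_mod_cast hr'
  refine le_liminf_of_le (by isBoundedDefault) ?_
  filter_upwards [h, eventually_const_mul_rpow_le C⁻¹ hr, eventually_gt_atTop 1] with x h1 h2 h3
  refine (le_logRatio_iff h3).2 ((ENNReal.ofReal_le_ofReal ?_).trans h1)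
  rwa [inv_mul_le_iff₀ hC] at h2

theorem logRatio_mono {N' : ℝ → ℕ∞} {x : ℝ} (hx : 1 < x) (h : N x ≤ N' x) :
    logRatio N x ≤ logRatio N' x := by
  have hl := Real.log_pos hx
  refine EReal.div_le_div_right_of_nonneg (by exact_mod_cast hl.le) ?_
  exact ENNReal.log_monotone (by exact_mod_cast h)

theorem limsup_logRatio_mono {N' : ℝ → ℕ∞} (h : ∀ᶠ x in atTop, N x ≤ N' x) :
    limsup (logRatio N) atTop ≤ limsup (logRatio N') atTop := by
  refine limsup_le_limsup ?_ (by isBoundedDefault) (by isBoundedDefault)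
  filter_upwards [h, eventually_gt_atTop 1] with x h1 h2
  exact logRatio_mono h2 h1

theorem liminf_logRatio_mono {N' : ℝ → ℕ∞} (h : ∀ᶠ x in atTop, N x ≤ N' x) :
    liminf (logRatio N) atTop ≤ liminf (logRatio N') atTop := by
  refine liminf_le_liminf ?_ (by isBoundedDefault) (by isBoundedDefault)
  filter_upwards [h, eventually_gt_atTop 1] with x h1 h2
  exact logRatio_mono h2 h1

theorem liminf_logRatio_le_limsup : liminf (logRatio N) atTop ≤ limsup (logRatio N) atTop :=
  liminf_le_limsup (by isBoundedDefault) (by isBoundedDefault)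

end Growth

/-! ### Spectral dimensions and reduced entropies of sums. -/

section SpectralDimension

variable {ν ν₁ ν₂ : Measure ℝ} [IsFiniteMeasure ν] [IsFiniteMeasure ν₁] [IsFiniteMeasure ν₂]

theorem lowerSpectralDim_mono (h₁ : ν₁ (Ioo 0 1)ᶜ = 0) (h₂ : ν₂ (Ioo 0 1)ᶜ = 0) (hle : ν₁ ≤ ν₂) :
    lowerSpectralDim ν₁ ≤ lowerSpectralDim ν₂ :=
  liminf_logRatio_mono <| (eventually_gt_atTop 0).mono fun _ hx => eigenvalueCount_mono h₁ h₂ hle hx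

theorem upperSpectralDim_mono (h₁ : ν₁ (Ioo 0 1)ᶜ = 0) (h₂ : ν₂ (Ioo 0 1)ᶜ = 0) (hle : ν₁ ≤ ν₂) :
    upperSpectralDim ν₁ ≤ upperSpectralDim ν₂ :=
  limsup_logRatio_mono <| (eventually_gt_atTop 0).mono fun _ hx => eigenvalueCount_mono h₁ h₂ hle hx

theorem upperSpectralDim_add (h₁ : ν₁ (Ioo 0 1)ᶜ = 0) (h₂ : ν₂ (Ioo 0 1)ᶜ = 0) :
    upperSpectralDim (ν₁ + ν₂) = max (upperSpectralDim ν₁) (upperSpectralDim ν₂) := by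
  have h := add_compl_Ioo_eq_zero h₁ h₂
  apply le_antisymm
  · refine EReal.le_of_forall_lt_iff_le.1 fun r hr => ?_
    rw [max_lt_iff] at hr
    -- Two counts, each at most `(2x)^r`.
    refine limsup_logRatio_le (2 * 2 ^ r) ?_
    have ht : Tendsto (fun x : ℝ => 2 * x) atTop atTop :=
      tendsto_id.const_mul_atTop two_pos
    filter_upwards [ht.eventually (eventually_le_rpow_of_limsup_lt hr.1),
      ht.eventually (eventually_le_rpow_of_limsup_lt hr.2), eventually_gt_atTop 0] with x hx₁ hx₂ hx
    have hadd : ((eigenvalueCount (ν₁ + ν₂) x : ℕ∞) : ℝ≥0∞) ≤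
        ((eigenvalueCount ν₁ (2 * x) + eigenvalueCount ν₂ (2 * x) : ℕ∞) : ℝ≥0∞) := by
      exact_mod_cast eigenvalueCount_add_le h₁ h₂ hx
    refine hadd.trans ?_
    push_cast
    refine (add_le_add hx₁ hx₂).trans ?_
    rw [← ENNReal.ofReal_add (by positivity) (by positivity), Real.mul_rpow two_pos.le hx.le]
    exact ENNReal.ofReal_le_ofReal (by linarith)
  · exact max_le (upperSpectralDim_mono h₁ h (Measure.le_add_right le_rfl))
      (upperSpectralDim_mono h₂ h (Measure.le_add_left le_rfl))

theorem upperSpectralDim_le_upperEntropy (hν : ν (Ioo 0 1)ᶜ = 0) :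
    upperSpectralDim ν ≤ upperEntropy ν :=
  limsup_logRatio_mono <| (eventually_gt_atTop 0).mono fun _ hx =>
    eigenvalueCount_le_partitionCount hν hx

theorem lowerReducedEntropy_le_lowerSpectralDim (hν : ν (Ioo 0 1)ᶜ = 0) {m : ℝ} (hm : 1 < m) :
    lowerReducedEntropy ν m ≤ lowerSpectralDim ν :=
  liminf_logRatio_mono <| (eventually_gt_atTop 0).mono fun _ hx =>
    packingCount_le_eigenvalueCount hν hm hx

theorem one_le_partitionCount (ν : Measure ℝ) (x : ℝ) : 1 ≤ partitionCount ν x := by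
  refine le_iInf₂ fun n => ?_
  rintro ⟨c, ⟨-, h0, h1, -⟩, -⟩
  rcases n with _ | n
  · rw [Fin.last_zero, h0] at h1
    exact absurd h1 zero_ne_one
  · exact_mod_cast Nat.succ_le_succ n.zero_le

theorem upperEntropy_nonneg (ν : Measure ℝ) : 0 ≤ upperEntropy ν := by
  refine le_limsup_of_frequently_le (Eventually.frequently ?_) (by isBoundedDefault)
  filter_upwards [eventually_gt_atTop 1] with x hx
  rw [← EReal.coe_zero, le_logRatio_iff hx, Real.rpow_zero, ENNReal.ofReal_one]
  exact_mod_cast one_le_partitionCount ν x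

theorem countable_atoms (ν : Measure ℝ) [IsFiniteMeasure ν] : {y : ℝ | ν {y} ≠ 0}.Countable := by
  have := Measure.countable_meas_pos_of_disjoint_iUnion (μ := ν) (As := fun y : ℝ => {y})
    (fun y => measurableSet_singleton y) (fun y z hyz => disjoint_singleton.2 hyz)
  simpa [pos_iff_ne_zero] using this

/-- The intervals of a packing for `ν₁` can be shrunk so that their endpoints avoid the
atoms of a larger measure. -/
theorem packingCount_le_packingCount_of_le (hle : ν₁ ≤ ν₂) {m m' x : ℝ} (hm' : 1 < m')
    (hm : m' < m) : packingCount ν₁ m x ≤ packingCount ν₂ m' ((m - 1) / (m' - 1) * x) := by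
  refine iSup₂_le fun n => ?_
  rintro ⟨a, b, hab, hdisj, hcore⟩
  have hm0 : 0 < m := by linarith
  have hm'0 : 0 < m' := by linarith
  have hm'1 : 0 < m' - 1 := by linarith
  have hatoms := countable_atoms ν₂
  -- The upper bound on `ε` ensures that the `m'`-core of the shrunken interval still contains the
  -- `m`-core of the original. Countably many atoms leave a dense set of admissible `ε`.
  have hex : ∀ k, ∃ ε : ℝ, 0 < ε ∧ ε < (b k - a k) * (1 - m' / m) / 2 ∧
      ν₂ {a k + ε} = 0 ∧ ν₂ {b k - ε} = 0 := by
    intro k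
    have hpos : 0 < (b k - a k) * (1 - m' / m) / 2 := by
      have h1 := sub_pos.2 (hab k).2.1
      have h2 : 0 < 1 - m' / m := sub_pos.2 ((div_lt_one hm0).2 hm)
      positivity
    have hcount : ((fun ε => a k + ε) ⁻¹' {y : ℝ | ν₂ {y} ≠ 0} ∪
        (fun ε => b k - ε) ⁻¹' {y : ℝ | ν₂ {y} ≠ 0}).Countable :=
      (hatoms.preimage (add_right_injective _)).union
        (hatoms.preimage sub_right_injective)
    obtain ⟨ε, hε, hε'⟩ := (hcount.dense_compl ℝ).exists_between hpos
    simp only [mem_compl_iff, mem_union, mem_preimage, mem_ofPred_eq, not_or, not_not] at hε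
    exact ⟨ε, hε'.1, hε'.2, hε.1, hε.2⟩
  choose ε hε0 hε1 hεa hεb using hex
  have hε2 : ∀ k, (b k - a k) / m ≤ (b k - ε k - (a k + ε k)) / m' := by
    intro k
    rw [le_div_iff₀ hm'0]
    have h1 := hε1 k
    have h2 : (b k - a k) / m * m' = (b k - a k) - (b k - a k) * (1 - m' / m) := by
      field_simp; ring
    rw [h2]; linarith
  have hε3 : ∀ k, a k + ε k < b k - ε k := by
    intro k
    have h1 : 0 < (b k - a k) / m := div_pos (sub_pos.2 (hab k).2.1) hm0
    have h2 := h1.trans_le (hε2 k)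
    have h3 := (div_pos_iff_of_pos_right hm'0).1 h2
    linarith
  refine le_iSup₂_of_le n ⟨fun k => a k + ε k, fun k => b k - ε k, fun k => ⟨?_, hε3 k, ?_,
    hεa k, hεb k⟩, fun j k hjk => ?_, fun k => ?_⟩ le_rfl
  · linarith [(hab k).1, hε0 k]
  · linarith [(hab k).2.2.1, hε0 k]
  · exact (hdisj hjk).mono (Ioo_subset_Ioo (by linarith [hε0 j]) (by linarith [hε0 j]))
      (Ioo_subset_Ioo (by linarith [hε0 k]) (by linarith [hε0 k]))
  · have h1 : (m - 1) / (m' - 1) * x * (m' - 1) = x * (m - 1) := by field_simp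
    rw [h1]
    refine (hcore k).trans (mul_le_mul ?_ (hε2 k) ?_ measureReal_nonneg)
    · have hsub : core m (a k) (b k) ⊆ core m' (a k + ε k) (b k - ε k) := by
        have h2 : (b k - a k) / (2 * m) ≤ (b k - ε k - (a k + ε k)) / (2 * m') := by
          rw [mul_comm 2 m, mul_comm 2 m', ← div_div, ← div_div]
          linarith [hε2 k]
        exact Icc_subset_Icc (by linarith) (by linarith)
      exact (measureReal_mono hsub).trans
        (ENNReal.toReal_mono (measure_ne_top _ _) (hle _))
    · exact (div_pos (sub_pos.2 (hab k).2.1) hm0).le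

theorem lowerReducedEntropy_le_of_le (hle : ν₁ ≤ ν₂) {m m' : ℝ} (hm' : 1 < m') (hm : m' < m) :
    lowerReducedEntropy ν₁ m ≤ lowerReducedEntropy ν₂ m' := by
  refine EReal.ge_of_forall_gt_iff_ge.1 fun r hr => ?_
  have hc : 0 < (m - 1) / (m' - 1) := div_pos (by linarith) (by linarith)
  set c := (m - 1) / (m' - 1) with hcdef
  refine le_liminf_logRatio (C := (c⁻¹) ^ r) (Real.rpow_pos_of_pos (inv_pos.2 hc) r) ?_
  have ht : Tendsto (fun x : ℝ => c⁻¹ * x) atTop atTop :=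
    tendsto_id.const_mul_atTop (inv_pos.2 hc)
  filter_upwards [ht.eventually (eventually_rpow_le_of_lt_liminf hr), eventually_gt_atTop 0]
    with x hx hx0
  rw [← Real.mul_rpow (inv_pos.2 hc).le hx0.le]
  refine hx.trans ?_
  have h := packingCount_le_packingCount_of_le hle (x := c⁻¹ * x) hm' hm
  rw [← hcdef, mul_inv_cancel_left₀ hc.ne'] at h
  exact_mod_cast h

/-- For fixed `m` monotonicity is not immediate, as endpoints may be atoms of the larger measure.
Shrinking the intervals costs a decrease of `m`, which the supremum over all `m > 1` absorbs. -/
theorem iSup_lowerReducedEntropy_mono (hle : ν₁ ≤ ν₂) :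
    (⨆ (m : ℝ) (_ : 1 < m), lowerReducedEntropy ν₁ m) ≤
      ⨆ (m : ℝ) (_ : 1 < m), lowerReducedEntropy ν₂ m := by
  refine iSup₂_le fun m hm => ?_
  refine (lowerReducedEntropy_le_of_le hle (m' := (1 + m) / 2) (by linarith) (by linarith)).trans ?_
  exact le_iSup₂ (f := fun (m : ℝ) (_ : 1 < m) => lowerReducedEntropy ν₂ m) ((1 + m) / 2)
    (by linarith)

end SpectralDimension

/-! ### Heavy dyadic intervals and multifractal dimensions. -/

/-- The dyadic interval `(k 2⁻ⁿ, (k + 1) 2⁻ⁿ]`. -/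
def dyadicIoc (n k : ℕ) : Set ℝ := Ioc ((k : ℝ) / 2 ^ n) (((k : ℝ) + 1) / 2 ^ n)

/-- The number of dyadic intervals of order `n` and measure at least `t`. -/
noncomputable def heavyCount (ν : Measure ℝ) (t : ℝ) (n : ℕ) : ℕ :=
  {k : ℕ | k < 2 ^ n ∧ t ≤ ν.real (dyadicIoc n k)}.ncard

theorem dyadicCount_eq_heavyCount (ν : Measure ℝ) (α : ℝ) (n : ℕ) :
    dyadicCount ν α n = heavyCount ν (2 ^ (-α * n)) n := rfl

open Classical in
theorem heavyCount_eq_card (ν : Measure ℝ) (t : ℝ) (n : ℕ) :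
    heavyCount ν t n = {k ∈ Finset.range (2 ^ n) | t ≤ ν.real (dyadicIoc n k)}.card := by
  rw [heavyCount, ← ncard_coe_finset]
  congr 1
  ext k
  simp

theorem heavyCount_le_two_pow (ν : Measure ℝ) (t : ℝ) (n : ℕ) : heavyCount ν t n ≤ 2 ^ n := by
  classical
  rw [heavyCount_eq_card]
  exact (Finset.card_filter_le _ _).trans (Finset.card_range _).le

theorem heavyCount_anti (ν : Measure ℝ) {s t : ℝ} (h : s ≤ t) (n : ℕ) :
    heavyCount ν t n ≤ heavyCount ν s n := by
  classical
  rw [heavyCount_eq_card, heavyCount_eq_card]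
  exact Finset.card_le_card fun k hk => by
    rw [Finset.mem_filter] at hk ⊢
    exact ⟨hk.1, h.trans hk.2⟩

theorem heavyCount_mono {ν₁ ν₂ : Measure ℝ} [IsFiniteMeasure ν₂] (hle : ν₁ ≤ ν₂) (t : ℝ) (n : ℕ) :
    heavyCount ν₁ t n ≤ heavyCount ν₂ t n := by
  classical
  rw [heavyCount_eq_card, heavyCount_eq_card]
  exact Finset.card_le_card fun k hk => by
    rw [Finset.mem_filter] at hk ⊢
    exact ⟨hk.1, hk.2.trans (ENNReal.toReal_mono (measure_ne_top _ _) (hle _))⟩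

section Heavy

variable {ν : Measure ℝ} [IsFiniteMeasure ν]

/-- A dyadic interval is, up to its endpoint, the core for `m = 3` of the interval formed with its
two neighbours. Equal residues mod 3 keep these triples disjoint, and the bounds on `k` keep them in
`[0, 1]`. -/
theorem card_le_eigenvalueCount_of_heavy (hν : ν (Ioo 0 1)ᶜ = 0) {t : ℝ} (ht : 0 < t) {n : ℕ}
    (F : Finset ℕ) (hF : ∀ k ∈ F, 1 ≤ k ∧ k + 2 ≤ 2 ^ n ∧ t ≤ ν.real (dyadicIoc n k))
    (hmod : ∀ j ∈ F, ∀ k ∈ F, j % 3 = k % 3) :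
    (F.card : ℕ∞) ≤ eigenvalueCount ν (2 * 2 ^ n / t) := by
  have h2 : (0 : ℝ) < 2 ^ n := by positivity
  let e : Fin F.card → ℕ := fun i => F.equivFin.symm i
  have he : ∀ i, e i ∈ F := fun i => (F.equivFin.symm i).2
  have hinj : Function.Injective e := Subtype.val_injective.comp F.equivFin.symm.injective
  refine card_le_eigenvalueCount hν (m := 3) (by norm_num) (by positivity)
    (fun i => ((e i : ℝ) - 1) / 2 ^ n) (fun i => ((e i : ℝ) + 2) / 2 ^ n) (fun i => ?_)
    (fun i j hij => ?_) fun i => ?_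
  · obtain ⟨h1, h3, -⟩ := hF _ (he i)
    have h1' : (1 : ℝ) ≤ e i := by exact_mod_cast h1
    have h3' : (e i : ℝ) + 2 ≤ 2 ^ n := by exact_mod_cast h3
    refine ⟨div_nonneg (by linarith) h2.le, ?_, (div_le_one h2).2 h3'⟩
    exact div_lt_div_of_pos_right (by linarith) h2
  · have hne : e i ≠ e j := fun h => hij (hinj h)
    have hm := hmod _ (he i) _ (he j)
    simp only [Ioo_disjoint_Ioo, min_le_iff, le_max_iff]
    rcases lt_or_gt_of_ne hne with h | h
    · have h3 : e i + 3 ≤ e j := by omega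
      have h3' : (e i : ℝ) + 3 ≤ e j := by exact_mod_cast h3
      exact Or.inr (Or.inl (div_le_div_of_nonneg_right (by linarith) h2.le))
    · have h3 : e j + 3 ≤ e i := by omega
      have h3' : (e j : ℝ) + 3 ≤ e i := by exact_mod_cast h3
      exact Or.inl (Or.inr (div_le_div_of_nonneg_right (by linarith) h2.le))
  · have hcore : core 3 (((e i : ℝ) - 1) / 2 ^ n) (((e i : ℝ) + 2) / 2 ^ n) =
        Icc ((e i : ℝ) / 2 ^ n) (((e i : ℝ) + 1) / 2 ^ n) := by
      rw [core]
      congr 1 <;> field_simp <;> ring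
    have hle : t ≤ ν.real (core 3 (((e i : ℝ) - 1) / 2 ^ n) (((e i : ℝ) + 2) / 2 ^ n)) := by
      rw [hcore]
      exact (hF _ (he i)).2.2.trans (measureReal_mono Ioc_subset_Icc_self)
    calc 4 / (2 * 2 ^ n / t * (3 - 1)) = t * (1 / 2 ^ n) := by field_simp; norm_num
      _ ≤ _ := by
        refine mul_le_mul hle (le_of_eq ?_) (by positivity) measureReal_nonneg
        field_simp
        ring

/-- Three residue classes, plus the first and last dyadic intervals, which lack a neighbour. -/
theorem heavyCount_le_eigenvalueCount (hν : ν (Ioo 0 1)ᶜ = 0) {t : ℝ} (ht : 0 < t) (n : ℕ) :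
    (heavyCount ν t n : ℕ∞) ≤ 2 + 3 * eigenvalueCount ν (2 * 2 ^ n / t) := by
  classical
  rw [heavyCount_eq_card]
  set F := {k ∈ Finset.range (2 ^ n) | t ≤ ν.real (dyadicIoc n k)} with hF
  let G : ℕ → Finset ℕ := fun i => {k ∈ F | 1 ≤ k ∧ k + 2 ≤ 2 ^ n ∧ k % 3 = i}
  have hcover : F ⊆ {0, 2 ^ n - 1} ∪ (G 0 ∪ (G 1 ∪ G 2)) := by
    intro k hk
    have hk2 : k < 2 ^ n := Finset.mem_range.1 (Finset.mem_filter.1 hk).1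
    simp only [Finset.mem_union, Finset.mem_insert, Finset.mem_singleton, G, Finset.mem_filter,
      hk, true_and]
    omega
  have hG : ∀ i, ((G i).card : ℕ∞) ≤ eigenvalueCount ν (2 * 2 ^ n / t) := fun i => by
    refine card_le_eigenvalueCount_of_heavy hν ht (G i) (fun k hk => ?_) fun j hj k hk => ?_
    · obtain ⟨h1, h2, h3, -⟩ := Finset.mem_filter.1 hk
      exact ⟨h2, h3, (Finset.mem_filter.1 h1).2⟩
    · rw [(Finset.mem_filter.1 hj).2.2.2, (Finset.mem_filter.1 hk).2.2.2]
  have hcard : F.card ≤ 2 + ((G 0).card + ((G 1).card + (G 2).card)) :=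
    (Finset.card_le_card hcover).trans <| (Finset.card_union_le _ _).trans <|
      add_le_add Finset.card_le_two <| (Finset.card_union_le _ _).trans <|
        add_le_add le_rfl (Finset.card_union_le _ _)
  calc (F.card : ℕ∞) ≤ 2 + ((G 0).card + ((G 1).card + (G 2).card)) := by exact_mod_cast hcard
    _ ≤ 2 + (eigenvalueCount ν (2 * 2 ^ n / t) + (eigenvalueCount ν (2 * 2 ^ n / t) +
        eigenvalueCount ν (2 * 2 ^ n / t))) :=
      add_le_add le_rfl (add_le_add (hG 0) (add_le_add (hG 1) (hG 2)))
    _ = 2 + 3 * eigenvalueCount ν (2 * 2 ^ n / t) := by ring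

end Heavy

theorem dyadicRatio_eq (ν : Measure ℝ) (α : ℝ) (n : ℕ) :
    dyadicRatio ν α n = ((Real.log (dyadicCount ν α n) / (n * Real.log 2) : ℝ) : EReal) := by
  rw [dyadicRatio, Real.log_of_nat_eq_posLog, Real.log_pow]

theorem dyadicRatio_nonneg (ν : Measure ℝ) (α : ℝ) (n : ℕ) : 0 ≤ dyadicRatio ν α n := by
  rw [dyadicRatio_eq]
  have := Real.log_natCast_nonneg (dyadicCount ν α n)
  have := Real.log_pos one_lt_two
  exact_mod_cast (by positivity)

theorem dyadicRatio_mono {ν₁ ν₂ : Measure ℝ} [IsFiniteMeasure ν₂] (hle : ν₁ ≤ ν₂) (α : ℝ) (n : ℕ) :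
    dyadicRatio ν₁ α n ≤ dyadicRatio ν₂ α n := by
  rw [dyadicRatio, dyadicRatio, EReal.coe_le_coe_iff]
  have h := heavyCount_mono hle (2 ^ (-α * n)) n
  have hlog : 0 ≤ Real.log (2 ^ n : ℝ) := Real.log_nonneg (one_le_pow₀ one_le_two)
  exact div_le_div_of_nonneg_right
    (Real.posLog_le_posLog (Nat.cast_nonneg _) (by exact_mod_cast h)) hlog

theorem lowerMFDim_mono {ν₁ ν₂ : Measure ℝ} [IsFiniteMeasure ν₂] (hle : ν₁ ≤ ν₂) :
    lowerMFDim ν₁ ≤ lowerMFDim ν₂ := by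
  refine iSup₂_mono fun α hα => ?_
  refine EReal.div_le_div_right_of_nonneg (by exact_mod_cast (by linarith : (0 : ℝ) ≤ 1 + α)) ?_
  exact liminf_le_liminf (Eventually.of_forall fun n => dyadicRatio_mono hle α n)
    (by isBoundedDefault) (by isBoundedDefault)

theorem lowerMFDim_le_upperMFDim (ν : Measure ℝ) : lowerMFDim ν ≤ upperMFDim ν := by
  refine iSup₂_mono fun α hα => ?_
  refine EReal.div_le_div_right_of_nonneg (by exact_mod_cast (by linarith : (0 : ℝ) ≤ 1 + α)) ?_
  exact liminf_le_limsup (by isBoundedDefault) (by isBoundedDefault)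

theorem upperMFDim_nonneg (ν : Measure ℝ) : 0 ≤ upperMFDim ν := by
  refine le_trans ?_ (le_iSup₂ (f := fun (α : ℝ) (_ : 0 < α) =>
    limsup (dyadicRatio ν α) atTop / ((1 + α : ℝ) : EReal)) 1 one_pos)
  refine EReal.div_nonneg ?_ (by exact_mod_cast (by norm_num : (0 : ℝ) ≤ 1 + 1))
  exact le_limsup_of_frequently_le (Frequently.of_forall fun n => dyadicRatio_nonneg ν 1 n)
    (by isBoundedDefault)

theorem limsup_dyadicRatio_le {ν : Measure ℝ} {α ρ K : ℝ} (hK : 1 ≤ K) (hρ : 0 ≤ ρ)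
    (h : ∀ᶠ n : ℕ in atTop, (dyadicCount ν α n : ℝ) ≤ K * 2 ^ (ρ * n)) :
    limsup (dyadicRatio ν α) atTop ≤ ρ := by
  have hlog2 := Real.log_pos one_lt_two
  have htend : Tendsto (fun n : ℕ => ((Real.log K / Real.log 2 / n + ρ : ℝ) : EReal)) atTop
      (𝓝 (ρ : EReal)) := by
    refine (continuous_coe_real_ereal.tendsto ρ).comp ?_
    simpa using (tendsto_const_div_atTop_nhds_zero_nat (Real.log K / Real.log 2)).add_const ρ
  rw [← htend.limsup_eq]
  refine limsup_le_limsup ?_ (by isBoundedDefault) (by isBoundedDefault)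
  filter_upwards [h, eventually_gt_atTop 0] with n hn hn0
  have hn0' : (0 : ℝ) < n := by exact_mod_cast hn0
  rw [dyadicRatio_eq, EReal.coe_le_coe_iff, div_le_iff₀ (by positivity)]
  have h1 : Real.log (dyadicCount ν α n) ≤ Real.log K + ρ * n * Real.log 2 := by
    have hpow : (1 : ℝ) ≤ 2 ^ (ρ * n) := Real.one_le_rpow one_le_two (by positivity)
    rw [← Real.log_rpow two_pos, ← Real.log_mul (by positivity) (by positivity)]
    rcases Nat.eq_zero_or_pos (dyadicCount ν α n) with h0 | h0
    · rw [h0, Nat.cast_zero, Real.log_zero]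
      exact Real.log_nonneg (one_le_mul_of_one_le_of_one_le hK hpow)
    · exact Real.log_le_log (by exact_mod_cast h0) hn
  refine h1.trans (le_of_eq ?_)
  field_simp

theorem eventually_dyadicCount_le {ν : Measure ℝ} {α ρ : ℝ}
    (h : limsup (dyadicRatio ν α) atTop < ρ) :
    ∀ᶠ n : ℕ in atTop, (dyadicCount ν α n : ℝ) ≤ 2 ^ (ρ * n) := by
  have hlog2 := Real.log_pos one_lt_two
  filter_upwards [eventually_lt_of_limsup_lt h, eventually_gt_atTop 0] with n hn hn0
  have hn0' : (0 : ℝ) < n := by exact_mod_cast hn0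
  rw [dyadicRatio_eq, EReal.coe_lt_coe_iff, div_lt_iff₀ (by positivity)] at hn
  rcases Nat.eq_zero_or_pos (dyadicCount ν α n) with h0 | h0
  · rw [h0, Nat.cast_zero]; positivity
  · rw [← Real.log_le_log_iff (by exact_mod_cast h0) (by positivity), Real.log_rpow two_pos]
    linarith

/-- Mass `2^(-α n)` at length `2^(-n)` corresponds to eigenvalues of size about `2^((1 + α) n)`, so
a spectral exponent `r` bounds the dyadic exponent by `(1 + α) r`. This explains the normalisation
by `1 + α`. Positivity of `r` absorbs the two boundary intervals. -/
theorem upperMFDim_le_max_upperSpectralDim {ν : Measure ℝ} [IsFiniteMeasure ν]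
    (hν : ν (Ioo 0 1)ᶜ = 0) : upperMFDim ν ≤ max (upperSpectralDim ν) 0 := by
  refine iSup₂_le fun α hα => EReal.le_of_forall_lt_iff_le.1 fun r hr => ?_
  rw [max_lt_iff] at hr
  have hr0 : 0 < r := by exact_mod_cast hr.2
  have hα1 : 0 < 1 + α := by linarith
  rw [EReal.div_le_iff_le_mul (by exact_mod_cast hα1) (EReal.coe_ne_top _), ← EReal.coe_mul]
  have htend : Tendsto (fun n : ℕ => 2 * (2 : ℝ) ^ ((1 + α) * n)) atTop atTop := by
    refine Tendsto.const_mul_atTop two_pos ?_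
    exact (tendsto_rpow_atTop_of_base_gt_one _ one_lt_two).comp
      (tendsto_natCast_atTop_atTop.const_mul_atTop hα1)
  refine limsup_dyadicRatio_le (K := 2 + 3 * 2 ^ r) ?_ (by positivity) ?_
  · have : (0 : ℝ) < 2 ^ r := by positivity
    linarith
  filter_upwards [htend.eventually (eventually_le_rpow_of_limsup_lt hr.1)] with n hn
  have hx : 2 * (2 : ℝ) ^ ((1 + α) * n) = 2 * 2 ^ n / 2 ^ (-α * n) := by
    rw [mul_div_assoc, ← Real.rpow_natCast, ← Real.rpow_sub two_pos]
    ring_nf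
  rw [hx] at hn
  have h1 := heavyCount_le_eigenvalueCount hν (t := 2 ^ (-α * n)) (by positivity) n
  rw [← dyadicCount_eq_heavyCount] at h1
  have h2 : ((dyadicCount ν α n : ℕ∞) : ℝ≥0∞) ≤
      ((2 + 3 * eigenvalueCount ν (2 * 2 ^ n / 2 ^ (-α * n)) : ℕ∞) : ℝ≥0∞) := by
    exact_mod_cast h1
  push_cast at h2
  have h3 : ENNReal.ofReal (dyadicCount ν α n) ≤
      ENNReal.ofReal (2 + 3 * (2 * 2 ^ n / 2 ^ (-α * n)) ^ r) := by
    rw [ENNReal.ofReal_natCast, ENNReal.ofReal_add (by positivity) (by positivity),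
      ENNReal.ofReal_mul (by positivity), ENNReal.ofReal_ofNat, ENNReal.ofReal_ofNat]
    refine h2.trans ?_
    gcongr
  rw [ENNReal.ofReal_le_ofReal_iff (by positivity), ← hx,
    Real.mul_rpow two_pos.le (by positivity), ← Real.rpow_mul two_pos.le] at h3
  have h4 : (1 : ℝ) ≤ 2 ^ ((1 + α) * r * n) := Real.one_le_rpow one_le_two (by positivity)
  have h5 : (1 + α) * n * r = (1 + α) * r * n := by ring
  rw [h5] at h3
  linarith

/-! ### Stopping-time partitions. -/

/-- There is a partition of `(u, v]` into `n` half-open intervals `C` with `ν(C) Λ(C) < t`; the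
endpoints are allowed to be atoms. -/
def HasFinePartition (ν : Measure ℝ) (t u v : ℝ) (n : ℕ) : Prop :=
  ∃ c : ℕ → ℝ, c 0 = u ∧ c n = v ∧
    ∀ k < n, c k < c (k + 1) ∧ ν.real (Ioc (c k) (c (k + 1))) * (c (k + 1) - c k) < t

theorem HasFinePartition.single {ν : Measure ℝ} {t u v : ℝ} (huv : u < v)
    (h : ν.real (Ioc u v) * (v - u) < t) : HasFinePartition ν t u v 1 := by
  refine ⟨fun k => if k = 0 then u else v, rfl, rfl, fun k hk => ?_⟩
  obtain rfl : k = 0 := by omega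
  exact ⟨huv, h⟩

theorem HasFinePartition.append {ν : Measure ℝ} {t u v w : ℝ} {n n' : ℕ}
    (h : HasFinePartition ν t u v n) (h' : HasFinePartition ν t v w n') :
    HasFinePartition ν t u w (n + n') := by
  obtain ⟨c, h0, h1, h2⟩ := h
  obtain ⟨c', h0', h1', h2'⟩ := h'
  have hle : ∀ k ≤ n, (if k ≤ n then c k else c' (k - n)) = c k := fun k hk => if_pos hk
  have hge : ∀ k, n ≤ k → (if k ≤ n then c k else c' (k - n)) = c' (k - n) := by
    intro k hk
    rcases hk.eq_or_lt with rfl | hk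
    · rw [if_pos le_rfl, h1, Nat.sub_self, h0']
    · exact if_neg hk.not_ge
  refine ⟨fun k => if k ≤ n then c k else c' (k - n), ?_, ?_, fun k hk => ?_⟩
  · dsimp only
    rw [hle 0 n.zero_le, h0]
  · dsimp only
    rw [hge _ (Nat.le_add_right n n'), Nat.add_sub_cancel_left, h1']
  · dsimp only
    rcases lt_or_ge k n with hkn | hkn
    · rw [hle k hkn.le, hle (k + 1) hkn]
      exact h2 k hkn
    · rw [hge k hkn, hge (k + 1) (by omega), Nat.sub_add_comm hkn]
      exact h2' (k - n) (by omega)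

open Classical in
/-- The dyadic stopping time partition: a dyadic interval `C` is split as long as
`ν(C) Λ(C) ≥ t`. -/
theorem exists_hasFinePartition_dyadic (ν : Measure ℝ) (t : ℝ) (d n k : ℕ)
    (hd : ∀ j, ν.real (dyadicIoc (n + d) j) < t * 2 ^ (n + d)) :
    ∃ N ≤ 1 + ∑ i ∈ Finset.range d, {j ∈ Finset.Ico (k * 2 ^ i) ((k + 1) * 2 ^ i) |
        t * 2 ^ (n + i) ≤ ν.real (dyadicIoc (n + i) j)}.card,
      HasFinePartition ν t ((k : ℝ) / 2 ^ n) (((k : ℝ) + 1) / 2 ^ n) N := by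
  have hgood : ∀ n k : ℕ, ν.real (dyadicIoc n k) < t * 2 ^ n →
      HasFinePartition ν t ((k : ℝ) / 2 ^ n) (((k : ℝ) + 1) / 2 ^ n) 1 := by
    intro n k h
    have h2 : (0 : ℝ) < 2 ^ n := by positivity
    refine HasFinePartition.single (div_lt_div_of_pos_right (by linarith) h2) ?_
    rw [← sub_div, add_sub_cancel_left, mul_one_div, div_lt_iff₀ h2]
    exact h
  induction d generalizing n k with
  | zero => exact ⟨1, by simp, hgood n k (hd k)⟩
  | succ d ih =>
    by_cases hbad : ν.real (dyadicIoc n k) < t * 2 ^ n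
    · exact ⟨1, Nat.le_add_right _ _, hgood n k hbad⟩
    · have hd' : ∀ j, ν.real (dyadicIoc (n + 1 + d) j) < t * 2 ^ (n + 1 + d) := by
        rw [show n + 1 + d = n + (d + 1) by ring]
        exact hd
      obtain ⟨N₁, hN₁, hp₁⟩ := ih (n + 1) (2 * k) hd'
      obtain ⟨N₂, hN₂, hp₂⟩ := ih (n + 1) (2 * k + 1) hd'
      have e1 : ((2 * k : ℕ) : ℝ) / 2 ^ (n + 1) = (k : ℝ) / 2 ^ n := by
        push_cast; rw [pow_succ]; field_simp
      have e2 : (((2 * k : ℕ) : ℝ) + 1) / 2 ^ (n + 1) = ((2 * k + 1 : ℕ) : ℝ) / 2 ^ (n + 1) := by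
        push_cast; rfl
      have e3 : (((2 * k + 1 : ℕ) : ℝ) + 1) / 2 ^ (n + 1) = ((k : ℝ) + 1) / 2 ^ n := by
        push_cast; rw [pow_succ]; field_simp; ring
      rw [e1, e2] at hp₁
      rw [e3] at hp₂
      refine ⟨N₁ + N₂, ?_, hp₁.append hp₂⟩
      rw [Finset.sum_range_succ']
      -- The split interval is itself heavy: its term `i = 0` pays for the second `1` arising from
      -- the two halves, just as a binary tree has one leaf more than inner nodes.
      have hlast : {j ∈ Finset.Ico (k * 2 ^ 0) ((k + 1) * 2 ^ 0) |
          t * 2 ^ (n + 0) ≤ ν.real (dyadicIoc (n + 0) j)}.card = 1 := by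
        rw [pow_zero, mul_one, mul_one, Nat.Ico_succ_singleton, Finset.filter_singleton, add_zero,
          if_pos (not_lt.1 hbad), Finset.card_singleton]
      have hsum : ∀ i, {j ∈ Finset.Ico (2 * k * 2 ^ i) ((2 * k + 1) * 2 ^ i) |
            t * 2 ^ (n + 1 + i) ≤ ν.real (dyadicIoc (n + 1 + i) j)}.card +
          {j ∈ Finset.Ico ((2 * k + 1) * 2 ^ i) ((2 * k + 1 + 1) * 2 ^ i) |
            t * 2 ^ (n + 1 + i) ≤ ν.real (dyadicIoc (n + 1 + i) j)}.card =
          {j ∈ Finset.Ico (k * 2 ^ (i + 1)) ((k + 1) * 2 ^ (i + 1)) |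
            t * 2 ^ (n + (i + 1)) ≤ ν.real (dyadicIoc (n + (i + 1)) j)}.card := by
        intro i
        have hu : Finset.Ico (k * 2 ^ (i + 1)) ((k + 1) * 2 ^ (i + 1)) =
            Finset.Ico (2 * k * 2 ^ i) ((2 * k + 1) * 2 ^ i) ∪
              Finset.Ico ((2 * k + 1) * 2 ^ i) ((2 * k + 1 + 1) * 2 ^ i) := by
          rw [Finset.Ico_union_Ico_eq_Ico (Nat.mul_le_mul_right _ (by omega))
            (Nat.mul_le_mul_right _ (by omega))]
          congr 1 <;> ring
        rw [hu, Finset.filter_union, Finset.card_union_of_disjoint]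
        · rw [show n + 1 + i = n + (i + 1) by ring]
        · exact Finset.disjoint_filter_filter (Finset.Ico_disjoint_Ico_consecutive _ _ _)
      rw [hlast, ← Finset.sum_congr rfl fun i _ => hsum i, Finset.sum_add_distrib]
      omega

/-! ### Partition entropy is at most the upper multifractal dimension. -/

section Entropy

variable {ν : Measure ℝ} [IsFiniteMeasure ν]

theorem tendsto_measureReal_Ioc_add (a b : ℝ) :
    Tendsto (fun ε => ν.real (Ioc a (b + ε))) (𝓝[>] 0) (𝓝 (ν.real (Ioc a b))) := by
  have h := tendsto_measure_biInter_gt (μ := ν) (s := fun ε : ℝ => Ioc a (b + ε)) (a := 0)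
    (fun r _ => measurableSet_Ioc.nullMeasurableSet)
    (fun i j _ hij => Ioc_subset_Ioc_right (by linarith)) ⟨1, one_pos, measure_ne_top _ _⟩
  have hI : ⋂ r > (0 : ℝ), Ioc a (b + r) = Ioc a b := by
    ext x
    simp only [mem_iInter, mem_Ioc]
    constructor
    · intro hx
      exact ⟨(hx 1 one_pos).1, le_of_forall_pos_le_add fun ε hε => (hx ε hε).2⟩
    · rintro ⟨h1, h2⟩ r hr
      exact ⟨h1, by linarith⟩
  rw [hI] at h
  exact (ENNReal.tendsto_toReal (measure_ne_top _ _)).comp h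

/-- The interior endpoints of a partition can be moved off the atoms. -/
theorem HasFinePartition.partitionCount_le (hν : ν (Ioo 0 1)ᶜ = 0) {x : ℝ} {n : ℕ}
    (h : HasFinePartition ν (1 / x) 0 1 n) : partitionCount ν x ≤ n := by
  obtain ⟨c, h0, h1, h2⟩ := h
  -- All interior endpoints move right by the same `ε`. Every new cell lies in `(c k, c (k + 1) +
  -- ε]`, and continuity from above of `ν` preserves the strict bounds for small `ε`.
  have hev : ∀ᶠ ε in 𝓝[>] (0 : ℝ), ∀ k ∈ Finset.range n, ε < c (k + 1) - c k ∧
      ν.real (Ioc (c k) (c (k + 1) + ε)) * (c (k + 1) + ε - c k) < 1 / x := by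
    rw [Filter.eventually_all_finset]
    intro k hk
    obtain ⟨hlt, hsmall⟩ := h2 k (Finset.mem_range.1 hk)
    have hgap : ∀ᶠ ε in 𝓝[>] (0 : ℝ), ε < c (k + 1) - c k :=
      mem_nhdsWithin_of_mem_nhds (Iio_mem_nhds (sub_pos.2 hlt))
    refine hgap.and ?_
    have hlen : Tendsto (fun ε : ℝ => c (k + 1) + ε - c k) (𝓝[>] 0) (𝓝 (c (k + 1) - c k)) := by
      have : Continuous fun ε : ℝ => c (k + 1) + ε - c k := by fun_prop
      simpa using (this.tendsto 0).mono_left nhdsWithin_le_nhds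
    exact ((tendsto_measureReal_Ioc_add _ _).mul hlen).eventually_lt_const hsmall
  obtain ⟨δ, hδ, hδ'⟩ := mem_nhdsGT_iff_exists_Ioo_subset.1 hev
  have hcount : (⋃ k, (fun ε => c k + ε) ⁻¹' {y : ℝ | ν {y} ≠ 0}).Countable :=
    countable_iUnion fun k => (countable_atoms ν).preimage (add_right_injective _)
  obtain ⟨ε, hε, hε'⟩ := (hcount.dense_compl ℝ).exists_between hδ
  simp only [mem_compl_iff, mem_iUnion, mem_preimage, mem_ofPred_eq, not_exists, not_not] at hε
  have hgood := hδ' hε'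
  -- The endpoints `0` and `1` stay put; they are not atoms because `ν` lives on the open interval.
  let s : ℕ → ℝ := fun k => if 0 < k ∧ k < n then ε else 0
  have hs0 : ∀ k, 0 ≤ s k := fun k => by
    simp only [s]; split_ifs
    · exact hε'.1.le
    · exact le_rfl
  have hs1 : ∀ k, s k ≤ ε := fun k => by
    simp only [s]; split_ifs
    · exact le_rfl
    · exact hε'.1.le
  have hend : ∀ y ∉ Ioo (0 : ℝ) 1, ν {y} = 0 := fun y hy =>
    measure_mono_null (singleton_subset_iff.2 hy) hν
  refine iInf₂_le n ⟨fun i => c i + s i, ⟨Fin.strictMono_iff_lt_succ.2 fun k => ?_, ?_, ?_,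
    fun k => ?_⟩, fun k => ?_⟩
  · have := (hgood k (Finset.mem_range.2 k.2)).1
    simp only [Fin.val_castSucc, Fin.val_succ]
    linarith [hs1 k, hs0 (k + 1)]
  · simp [s, h0]
  · simp [s, h1]
  · by_cases hk : 0 < (k : ℕ) ∧ (k : ℕ) < n
    · simp only [s, if_pos hk]
      exact hε k
    · simp only [s, if_neg hk, add_zero]
      have : (k : ℕ) = 0 ∨ (k : ℕ) = n := by have := k.2; omega
      rcases this with h | h
      · rw [h, h0]; exact hend 0 (by simp)
      · rw [h, h1]; exact hend 1 (by simp)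
  · obtain ⟨hlt, hsm⟩ := hgood k (Finset.mem_range.2 k.2)
    simp only [Fin.val_castSucc, Fin.val_succ]
    refine lt_of_le_of_lt (mul_le_mul (measureReal_mono (Ioc_subset_Ioc ?_ ?_)) ?_ ?_
      measureReal_nonneg) hsm
    · linarith [hs0 k]
    · linarith [hs1 (k + 1)]
    · linarith [hs0 k, hs1 (k + 1)]
    · linarith [hs1 k, hs0 (k + 1)]

theorem partitionCount_le_sum_heavyCount (hν : ν (Ioo 0 1)ᶜ = 0) {x : ℝ} (hx : 0 < x) {d : ℕ}
    (hd : ν.real univ * x < 2 ^ d) :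
    partitionCount ν x ≤ (1 + ∑ i ∈ Finset.range d, heavyCount ν (2 ^ i / x) i : ℕ) := by
  classical
  have hd' : ∀ j, ν.real (dyadicIoc (0 + d) j) < 1 / x * 2 ^ (0 + d) := by
    intro j
    rw [zero_add, one_div, ← div_eq_inv_mul, lt_div_iff₀ hx]
    exact lt_of_le_of_lt (mul_le_mul_of_nonneg_right (measureReal_mono (subset_univ _)) hx.le) hd
  obtain ⟨N, hN, hp⟩ := exists_hasFinePartition_dyadic ν (1 / x) d 0 0 hd'
  have hp' : HasFinePartition ν (1 / x) 0 1 N := by simpa using hp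
  refine (hp'.partitionCount_le hν).trans ?_
  refine Nat.cast_le.2 (hN.trans (le_of_eq ?_))
  congr 1
  refine Finset.sum_congr rfl fun i _ => ?_
  rw [heavyCount_eq_card, zero_add, zero_mul, zero_add, one_mul, ← Finset.range_eq_Ico,
    one_div, ← div_eq_inv_mul]

/-- Bounds on the dyadic counts that are uniform in the exponent. -/
theorem exists_heavyCount_le {ν : Measure ℝ} {r δ c : ℝ} (hr : 0 < r) (hδ : 0 < δ) (hc : 0 ≤ c)
    (h : upperMFDim ν < r) :
    ∃ K : ℝ, 0 < K ∧ ∀ (y : ℝ) (i : ℕ), 0 ≤ y → i ≤ y + c →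
      (heavyCount ν (2 ^ i / 2 ^ y) i : ℝ) ≤ K * 2 ^ (r * (1 + 2 * δ) * (y + c)) := by
  -- A grid of mesh `δ`: only finitely many exponents, up to about `1 / r`, are needed, so a single
  -- `n₀` serves them all. Levels `i ≤ n₀` go into the constant `K`.
  let α : ℕ → ℝ := fun j => (j + 1) * δ
  have hα : ∀ j, 0 < α j := fun j => by positivity
  let A : ℝ := 1 / r
  have hA : 0 < A := by positivity
  have hev : ∀ᶠ n : ℕ in atTop, ∀ j ∈ Finset.range (⌈A / δ⌉₊ + 1),
      (dyadicCount ν (α j) n : ℝ) ≤ 2 ^ (r * (1 + α j) * n) := by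
    rw [Filter.eventually_all_finset]
    intro j _
    refine eventually_dyadicCount_le ?_
    have h1 : limsup (dyadicRatio ν (α j)) atTop / ((1 + α j : ℝ) : EReal) < r :=
      lt_of_le_of_lt (le_iSup₂ (f := fun (α : ℝ) (_ : 0 < α) =>
        limsup (dyadicRatio ν α) atTop / ((1 + α : ℝ) : EReal)) (α j) (hα j)) h
    have hpos : 0 < 1 + α j := by linarith [hα j]
    rwa [EReal.div_lt_iff (by exact_mod_cast hpos) (EReal.coe_ne_top _), ← EReal.coe_mul] at h1
  obtain ⟨n₀, hn₀⟩ := eventually_atTop.1 hev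
  refine ⟨2 ^ n₀, by positivity, fun y i hy hi => ?_⟩
  have hexp0 : 0 ≤ r * (1 + 2 * δ) * (y + c) := by positivity
  have hbig : (1 : ℝ) ≤ 2 ^ n₀ := one_le_pow₀ one_le_two
  have htriv : (heavyCount ν (2 ^ i / 2 ^ y) i : ℝ) ≤ 2 ^ i := by
    exact_mod_cast heavyCount_le_two_pow ν (2 ^ i / 2 ^ y) i
  rcases lt_or_ge i (n₀ + 1) with hlt | hge
  · refine htriv.trans ((pow_le_pow_right₀ one_le_two (Nat.lt_succ_iff.1 hlt)).trans ?_)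
    exact le_mul_of_one_le_right (by positivity) (Real.one_le_rpow one_le_two hexp0)
  · suffices (heavyCount ν (2 ^ i / 2 ^ y) i : ℝ) ≤ 2 ^ (r * (1 + 2 * δ) * (y + c)) from
      this.trans (le_mul_of_one_le_left (by positivity) hbig)
    have hi0 : (0 : ℝ) < i := by
      have : 0 < i := by omega
      exact_mod_cast this
    -- If the threshold exponent exceeds `1 / r`, then `i < r y` and the trivial count `2^i` is
    -- already small enough.
    rcases lt_or_ge ((1 + A) * i) y with hlarge | hsmall
    · refine htriv.trans ?_
      rw [← Real.rpow_natCast]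
      refine Real.rpow_le_rpow_of_exponent_le one_le_two ?_
      have h1 : r * ((1 + A) * i) = (r + 1) * i := by simp only [A]; field_simp
      have h2 : r * ((1 + A) * i) ≤ r * y := mul_le_mul_of_nonneg_left hlarge.le hr.le
      have h3 : r * y ≤ r * (1 + 2 * δ) * (y + c) := by
        rw [mul_assoc]
        refine mul_le_mul_of_nonneg_left ?_ hr.le
        nlinarith [mul_nonneg hδ.le hy, mul_nonneg hδ.le hc]
      nlinarith [mul_pos hr hi0]
    -- The threshold equals `2^(-β i)`, and `β` is rounded up to the grid. It may be negative, since
    -- levels up to `y + c` occur; then the first grid point `δ` is used.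
    · set β : ℝ := y / i - 1 with hβ
      have hβi : (1 + β) * i = y := by rw [hβ]; field_simp; ring
      have hβA : β ≤ A := by
        rw [hβ, sub_le_iff_le_add, div_le_iff₀ hi0]
        linarith
      set j := ⌈β / δ⌉₊ with hj
      have hjmem : j ∈ Finset.range (⌈A / δ⌉₊ + 1) := by
        rw [Finset.mem_range, Nat.lt_succ_iff]
        exact Nat.ceil_mono (div_le_div_of_nonneg_right hβA hδ.le)
      have hle1 : β ≤ α j := by
        have h1 : β / δ ≤ j := Nat.le_ceil _
        rw [div_le_iff₀ hδ] at h1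
        simp only [α]
        linarith
      have hle2 : α j ≤ max β 0 + 2 * δ := by
        rcases le_or_gt β 0 with hb | hb
        · have : j = 0 := Nat.ceil_eq_zero.2 (div_nonpos_of_nonpos_of_nonneg hb hδ.le)
          simp only [α, this, Nat.cast_zero]
          linarith [le_max_right β 0]
        · have h1 : (j : ℝ) < β / δ + 1 := Nat.ceil_lt_add_one (by positivity)
          have h2 : (j : ℝ) * δ < (β / δ + 1) * δ := mul_lt_mul_of_pos_right h1 hδ
          have h3 : (β / δ + 1) * δ = β + δ := by field_simp
          simp only [α]
          linarith [le_max_left β 0]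
      have hthr : (2 : ℝ) ^ (-α j * i) ≤ 2 ^ i / 2 ^ y := by
        rw [← Real.rpow_natCast, ← Real.rpow_sub two_pos]
        refine Real.rpow_le_rpow_of_exponent_le one_le_two ?_
        nlinarith [mul_le_mul_of_nonneg_right hle1 hi0.le]
      have hcount : (heavyCount ν (2 ^ i / 2 ^ y) i : ℝ) ≤ dyadicCount ν (α j) i := by
        rw [dyadicCount_eq_heavyCount]
        exact_mod_cast heavyCount_anti ν hthr i
      refine hcount.trans ((hn₀ i (by omega) j hjmem).trans ?_)
      refine Real.rpow_le_rpow_of_exponent_le one_le_two ?_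
      rw [mul_assoc, mul_assoc]
      refine mul_le_mul_of_nonneg_left ?_ hr.le
      have h1 : (1 + α j) * i ≤ (1 + max β 0 + 2 * δ) * i :=
        mul_le_mul_of_nonneg_right (by linarith) hi0.le
      have h2 : (1 + max β 0) * i ≤ y + c := by
        rcases max_cases β 0 with ⟨h, -⟩ | ⟨h, -⟩
        · rw [h, hβi]; linarith
        · rw [h]; linarith
      nlinarith [mul_le_mul_of_nonneg_left hi hδ.le]

/-- The stopping-time partition has at most one more cell than there are heavy intervals, spread
over about `log₂ x` levels. Each level contributes `O(x^ρ)`, and the logarithmic number of levels is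
absorbed by a larger power. -/
theorem upperEntropy_le_upperMFDim (hν : ν (Ioo 0 1)ᶜ = 0) : upperEntropy ν ≤ upperMFDim ν := by
  refine EReal.le_of_forall_lt_iff_le.1 fun z hz => ?_
  obtain ⟨r, hr, hrz⟩ := EReal.lt_iff_exists_real_btwn.1 hz
  have hr0 : 0 < r := by exact_mod_cast (upperMFDim_nonneg ν).trans_lt hr
  have hrz : r < z := by exact_mod_cast hrz
  -- Makes `ρ` the midpoint of `r` and `z`.
  set δ := (z - r) / (4 * r) with hδdef
  have hδ : 0 < δ := div_pos (by linarith) (by linarith)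
  set ρ := r * (1 + 2 * δ) with hρdef
  have hρ : ρ < z := by
    have : ρ = r + (z - r) / 2 := by rw [hρdef, hδdef]; field_simp; ring
    linarith
  have hz0 : 0 < z := hr0.trans hrz
  -- With `c = log₂ M ≥ 0`, levels beyond `y + c` contain no heavy intervals, since `2^(y + c) = M
  -- x` bounds the total mass times `x`.
  set M := max (ν.real univ) 1 with hM
  have hM1 : 1 ≤ M := le_max_right _ _
  set c := Real.logb 2 M with hc
  have hc0 : 0 ≤ c := Real.logb_nonneg one_lt_two hM1
  obtain ⟨K, hK, hbound⟩ := exists_heavyCount_le hr0 hδ hc0 hr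
  have hlog : ∀ᶠ x : ℝ in atTop, Real.logb 2 x + c + 1 ≤ x ^ (z - ρ) := by
    have h1 : (fun x => Real.logb 2 x + c + 1) =o[atTop] fun x : ℝ => x ^ (z - ρ) := by
      have hlo := isLittleO_log_rpow_atTop (sub_pos.2 hρ)
      have h2 : (fun x => Real.logb 2 x) =o[atTop] fun x : ℝ => x ^ (z - ρ) := by
        simp_rw [Real.logb, div_eq_inv_mul]
        exact hlo.const_mul_left _
      have h3 : (fun _ : ℝ => c + 1) =o[atTop] fun x : ℝ => x ^ (z - ρ) :=
        Asymptotics.isLittleO_const_left.2 (Or.inr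
          (tendsto_norm_atTop_atTop.comp (tendsto_rpow_atTop (sub_pos.2 hρ))))
      simpa [add_assoc] using h2.add h3
    filter_upwards [h1.bound one_pos, eventually_gt_atTop 0] with x hx hx0
    rw [one_mul, Real.norm_eq_abs, Real.norm_eq_abs,
      abs_of_nonneg (Real.rpow_nonneg hx0.le (z - ρ))] at hx
    exact (le_abs_self _).trans hx
  refine limsup_logRatio_le (1 + K * 2 ^ (ρ * c)) ?_
  filter_upwards [hlog, eventually_ge_atTop 1] with x hx hx1
  have hx0 : 0 < x := by linarith
  set y := Real.logb 2 x with hy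
  have hy0 : 0 ≤ y := Real.logb_nonneg one_lt_two hx1
  have hxy : (2 : ℝ) ^ y = x := Real.rpow_logb two_pos (by norm_num) hx0
  have hMc : (2 : ℝ) ^ c = M := Real.rpow_logb two_pos (by norm_num) (by linarith)
  set d := ⌊y + c⌋₊ + 1 with hd
  have hd1 : ν.real univ * x < 2 ^ d := by
    calc ν.real univ * x ≤ M * x := mul_le_mul_of_nonneg_right (le_max_left _ _) hx0.le
      _ = 2 ^ (y + c) := by rw [Real.rpow_add two_pos, hxy, hMc, mul_comm]
      _ < 2 ^ (d : ℝ) := by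
        refine Real.rpow_lt_rpow_of_exponent_lt one_lt_two ?_
        rw [hd]
        exact_mod_cast Nat.lt_floor_add_one (y + c)
      _ = 2 ^ d := Real.rpow_natCast _ _
  have hd2 : (d : ℝ) ≤ x ^ (z - ρ) := by
    have := Nat.floor_le (add_nonneg hy0 hc0)
    rw [hd]
    push_cast
    linarith
  have hterm : ∀ i ∈ Finset.range d,
      (heavyCount ν (2 ^ i / x) i : ℝ) ≤ K * 2 ^ (ρ * c) * x ^ ρ := by
    intro i hi
    have hi' : (i : ℝ) ≤ y + c :=
      (Nat.le_floor_iff (add_nonneg hy0 hc0)).1 (Nat.lt_succ_iff.1 (Finset.mem_range.1 hi))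
    have h1 := hbound y i hy0 hi'
    rw [hxy] at h1
    refine h1.trans (le_of_eq ?_)
    rw [mul_assoc K, ← hρdef, mul_add, Real.rpow_add two_pos, mul_comm ρ y,
      Real.rpow_mul two_pos.le, hxy, mul_comm (x ^ ρ)]
  have hsum : ((1 + ∑ i ∈ Finset.range d, heavyCount ν (2 ^ i / x) i : ℕ) : ℝ) ≤
      (1 + K * 2 ^ (ρ * c)) * x ^ z := by
    push_cast
    have h1 : ∑ i ∈ Finset.range d, (heavyCount ν (2 ^ i / x) i : ℝ) ≤
        d * (K * 2 ^ (ρ * c) * x ^ ρ) := by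
      simpa using Finset.sum_le_sum hterm
    have h2 : d * (K * 2 ^ (ρ * c) * x ^ ρ) ≤ x ^ (z - ρ) * (K * 2 ^ (ρ * c) * x ^ ρ) :=
      mul_le_mul_of_nonneg_right hd2 (by positivity)
    have h3 : x ^ (z - ρ) * (K * 2 ^ (ρ * c) * x ^ ρ) = K * 2 ^ (ρ * c) * x ^ z := by
      have : x ^ z = x ^ (z - ρ) * x ^ ρ := by rw [← Real.rpow_add hx0]; ring_nf
      rw [this]; ring
    have h4 : 1 ≤ x ^ z := Real.one_le_rpow hx1 hz0.le
    linarith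
  have hpc := partitionCount_le_sum_heavyCount hν hx0 hd1
  calc (partitionCount ν x : ℝ≥0∞)
      ≤ (((1 + ∑ i ∈ Finset.range d, heavyCount ν (2 ^ i / x) i : ℕ) : ℕ∞) : ℝ≥0∞) := by
        exact_mod_cast hpc
    _ = ENNReal.ofReal ((1 + ∑ i ∈ Finset.range d, heavyCount ν (2 ^ i / x) i : ℕ) : ℝ) := by
        rw [ENNReal.ofReal_natCast]; rfl
    _ ≤ _ := ENNReal.ofReal_le_ofReal hsum

end Entropy

/-! ### Regularity of sums. -/

section Sum

variable {ν₁ ν₂ : Measure ℝ} [IsFiniteMeasure ν₁] [IsFiniteMeasure ν₂]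

/-- The upper entropy of the sum goes down to that of `ν₁` through the spectral dimension, crosses
to the lower side by regularity of `ν₁`, and returns to the sum by monotonicity. -/
theorem IsRegular.add (h₁ : ν₁ (Ioo 0 1)ᶜ = 0) (h₂ : ν₂ (Ioo 0 1)ᶜ = 0)
    (hs : upperSpectralDim (ν₁ + ν₂) = upperSpectralDim ν₁) (hr : IsRegular ν₁) :
    IsRegular (ν₁ + ν₂) := by
  have h := add_compl_Ioo_eq_zero h₁ h₂
  apply le_antisymm
  · exact iSup₂_le fun m hm => (lowerReducedEntropy_le_lowerSpectralDim h hm).trans <|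
      liminf_logRatio_le_limsup.trans (upperSpectralDim_le_upperEntropy h)
  · calc upperEntropy (ν₁ + ν₂) ≤ upperMFDim (ν₁ + ν₂) := upperEntropy_le_upperMFDim h
      _ ≤ max (upperSpectralDim (ν₁ + ν₂)) 0 := upperMFDim_le_max_upperSpectralDim h
      _ ≤ upperEntropy ν₁ := by
        rw [hs]
        exact max_le (upperSpectralDim_le_upperEntropy h₁) (upperEntropy_nonneg ν₁)
      _ = ⨆ (m : ℝ) (_ : 1 < m), lowerReducedEntropy ν₁ m := hr.symm
      _ ≤ _ := iSup_lowerReducedEntropy_mono (Measure.le_add_right le_rfl)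

theorem IsMFRegular.add (h₁ : ν₁ (Ioo 0 1)ᶜ = 0) (h₂ : ν₂ (Ioo 0 1)ᶜ = 0)
    (hs : upperSpectralDim (ν₁ + ν₂) = upperSpectralDim ν₁) (hr : IsMFRegular ν₁) :
    IsMFRegular (ν₁ + ν₂) := by
  refine le_antisymm (lowerMFDim_le_upperMFDim _) ?_
  calc upperMFDim (ν₁ + ν₂) ≤ max (upperSpectralDim (ν₁ + ν₂)) 0 :=
        upperMFDim_le_max_upperSpectralDim (add_compl_Ioo_eq_zero h₁ h₂)
    _ ≤ upperMFDim ν₁ := by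
      rw [hs]
      exact max_le ((upperSpectralDim_le_upperEntropy h₁).trans (upperEntropy_le_upperMFDim h₁))
        (upperMFDim_nonneg ν₁)
    _ = lowerMFDim ν₁ := hr.symm
    _ ≤ _ := lowerMFDim_mono (Measure.le_add_right le_rfl)

end Sum

end KreinFeller

theorem corollary1p9 (ν₁ ν₂ : MeasureTheory.Measure ℝ)
    [MeasureTheory.IsFiniteMeasure ν₁] [MeasureTheory.IsFiniteMeasure ν₂]
    (hν₁ : ν₁ (Set.Ioo 0 1)ᶜ = 0) (hν₂ : ν₂ (Set.Ioo 0 1)ᶜ = 0) :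
    KreinFeller.upperSpectralDim (ν₁ + ν₂) =
        max (KreinFeller.upperSpectralDim ν₁) (KreinFeller.upperSpectralDim ν₂) ∧
    (KreinFeller.lowerSpectralDim ν₁ = KreinFeller.upperSpectralDim ν₁ →
      KreinFeller.upperSpectralDim ν₂ ≤ KreinFeller.upperSpectralDim ν₁ →
        (KreinFeller.lowerSpectralDim (ν₁ + ν₂) = KreinFeller.upperSpectralDim ν₁ ∧
          KreinFeller.upperSpectralDim (ν₁ + ν₂) = KreinFeller.upperSpectralDim ν₁) ∧
        (KreinFeller.IsRegular ν₁ → KreinFeller.IsRegular (ν₁ + ν₂)) ∧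
        (KreinFeller.IsMFRegular ν₁ → KreinFeller.IsMFRegular (ν₁ + ν₂))) := by
  have h := KreinFeller.add_compl_Ioo_eq_zero hν₁ hν₂
  have hadd := KreinFeller.upperSpectralDim_add hν₁ hν₂
  refine ⟨hadd, fun hlow hle => ?_⟩
  have hup : KreinFeller.upperSpectralDim (ν₁ + ν₂) = KreinFeller.upperSpectralDim ν₁ := by
    rw [hadd, max_eq_left hle]
  refine ⟨⟨le_antisymm ?_ ?_, hup⟩, fun hr => hr.add hν₁ hν₂ hup, fun hr => hr.add hν₁ hν₂ hup⟩
  · rw [← hup]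
    exact KreinFeller.liminf_logRatio_le_limsup
  · rw [← hlow]
    exact KreinFeller.lowerSpectralDim_mono hν₁ h (MeasureTheory.Measure.le_add_right le_rfl)
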